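/- Let $(X,\mathsf d,\mathfrak m)$ be a metric measure space, i.e. $(X,\mathsf d)$ is a complete separable metric space and $\mathfrak m\ge 0$ is a Borel measure on $X$ that is finite on bounded sets and has $\operatorname{supp}\mathfrak m=X$. Assume that $\operatorname{diam}(X)\le D<+\infty$ and that $X$ supports a weak local $(1,1)$-Poincaré inequality: there are a constant $\lambda\ge 1$ and a function $C_P:(0,\infty)\to(0,\infty)$ such that for every locally Lipschitz $f:X\to\mathbb R$ $$\frac{1}{\mathfrak m(B_r(x))}\int_{B_r(x)}\Big|f-f_{B_r(x)}\Big|\,d\mathfrak m\le C_P(R)\,r\,\frac{1}{\mathfrak m(B_{\lambda r}(x))}\int_{B_{\lambda r}(x)}\operatorname{lip}(f)\,d\mathfrak m\qquad\text{for all }0<r<R,\ x\in X\text{ such that } f\in L^1(B_r(x)),$$ where $f_A=\frac1{\mathfrak m(A)}\int_A f\,d\mathfrak m$ and $\operatorname{lip}(f)(x)=\limsup_{y\to x}\frac{|f(x)-f(y)|}{\mathsf d(x,y)}$ (and $\operatorname{lip}(f)(x)=0$ at isolated points $x$). No doubling condition is assumed. For $p\in(1,\infty)$ a Borel function $g:X\to[0,\infty]$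 is a $p$-weak upper gradient of $f:X\to\mathbb R$ if $|f(\gamma_a)-f(\gamma_b)|\le\int_\gamma g\,ds$ for all non-constant compact rectifiable curves $\gamma$ (with end points $\gamma_a,\gamma_b$) outside a family of zero $p$-modulus; $W^{1,p}(X)$ is the space of (classes of) functions in $L^p(\mathfrak m)$ that have a representative with a $p$-weak upper gradient in $L^p(\mathfrak m)$, and $|Df|_{p,w}$ denotes the ($\mathfrak m$-a.e.) minimal $p$-integrable $p$-weak upper gradient of $f\in W^{1,p}(X)$. Then for every $p\in(1,\infty)$ there is a constant $C>0$ such that $$\int_X|f-f_X|^p\,d\mathfrak m\le C\int_X|Df|_{p,w}^p\,d\mathfrak m\qquad\text{for all } f\in W^{1,p}(X).$$ Moreover the spectral gap $$\lambda_1(X)=\inf\Big\{\int_X|Du|_{2,w}^2\,d\mathfrak m:\ u\in W^{1,2}(X),\ \int_X u\,d\mathfrak m=0,\ \int_X u^2\,d\mathfrak m=1\Big\}\in[0,\infty]\qquad(\inf\emptyset=+\infty)$$ satisfies $\lambda_1(X)>0$. -/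

import Mathlib

open MeasureTheory Set Filter Topology
open scoped ENNReal NNReal

noncomputable section

namespace MMS

/-- The slope `lip f x = limsup_{y → x} |f x - f y| / d(x, y)`. At an isolated point the punctured
neighbourhood filter is trivial and the upper limit in `[0, ∞]` is `0`. -/
def slope {X : Type*} [MetricSpace X] (f : X → ℝ) (x : X) : ℝ≥0∞ :=
  limsup (fun y => edist (f x) (f y) / edist x y) (𝓝[≠] x)

/-- The weak local `(1,1)`-Poincaré inequality: there are `lam ≥ 1` and `CP : (0,∞) → (0,∞)` such
that the `(1,1)`-inequality holds on all balls of radius `r < R` for all locally Lipschitz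
functions (which are integrable on the ball, so that their mean value is defined). -/
def WeakLocalPoincare {X : Type*} [MetricSpace X] [MeasurableSpace X] (μ : Measure X) : Prop :=
  ∃ lam : ℝ, 1 ≤ lam ∧ ∃ CP : ℝ → ℝ≥0, (∀ R, 0 < R → 0 < CP R) ∧
    ∀ f : X → ℝ, LocallyLipschitz f →
      ∀ (R r : ℝ) (x : X), 0 < r → r < R → IntegrableOn f (Metric.ball x r) μ →
        ⨍⁻ y in Metric.ball x r, edist (f y) (⨍ z in Metric.ball x r, f z ∂μ) ∂μ ≤
          CP R * ENNReal.ofReal r * ⨍⁻ y in Metric.ball x (lam * r), slope f y ∂μ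

/-- A non-constant compact rectifiable curve, parametrized by arc length on `[a, b]`
(the values of `toFun` outside `[a, b]` are irrelevant). -/
structure RectCurve (X : Type*) [MetricSpace X] where
  a : ℝ
  b : ℝ
  lt : a < b
  toFun : ℝ → X
  unitSpeed : HasUnitSpeedOn toFun (Icc a b)

namespace RectCurve

/-- The line integral `∫_γ g ds`. -/
def lineIntegral {X : Type*} [MetricSpace X] (γ : RectCurve X) (g : X → ℝ≥0∞) : ℝ≥0∞ :=
  ∫⁻ t in Icc γ.a γ.b, g (γ.toFun t)

end RectCurve

/-- The `p`-modulus of a family of curves. -/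
def modulus {X : Type*} [MetricSpace X] [MeasurableSpace X] (p : ℝ) (μ : Measure X)
    (Γ : Set (RectCurve X)) : ℝ≥0∞ :=
  ⨅ (ρ : X → ℝ≥0∞) (_ : Measurable ρ ∧ ∀ γ ∈ Γ, 1 ≤ γ.lineIntegral ρ), ∫⁻ x, ρ x ^ p ∂μ

/-- `g` is a (Borel) `p`-weak upper gradient of the everywhere defined function `f`:
`|f(γ(a)) - f(γ(b))| ≤ ∫_γ g ds` for all curves `γ` outside a family of `p`-modulus zero. -/
def IsWeakUpperGradient {X : Type*} [MetricSpace X] [MeasurableSpace X] (p : ℝ) (μ : Measure X)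
    (f : X → ℝ) (g : X → ℝ≥0∞) : Prop :=
  Measurable g ∧
    modulus p μ {γ | ¬ edist (f (γ.toFun γ.a)) (f (γ.toFun γ.b)) ≤ γ.lineIntegral g} = 0

/-- `g` is a `p`-integrable `p`-weak upper gradient of (some representative of) the
`μ`-a.e. equivalence class of `f`. -/
def IsSobolevUpperGradient {X : Type*} [MetricSpace X] [MeasurableSpace X] (p : ℝ)
    (μ : Measure X) (f : X → ℝ) (g : X → ℝ≥0∞) : Prop :=
  ∫⁻ x, g x ^ p ∂μ < ∞ ∧ ∃ f' : X → ℝ, f' =ᵐ[μ] f ∧ IsWeakUpperGradient p μ f' g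

/-- `f` belongs to the Sobolev space `W^{1,p}(X)`. -/
def MemSobolev {X : Type*} [MetricSpace X] [MeasurableSpace X] (p : ℝ) (μ : Measure X)
    (f : X → ℝ) : Prop :=
  MemLp f (ENNReal.ofReal p) μ ∧ ∃ g, IsSobolevUpperGradient p μ f g

/-- `g` is a minimal `p`-weak upper gradient of `f`: it is, up to a null set, the smallest among
all `p`-integrable `p`-weak upper gradients. -/
def IsMinimalUpperGradient {X : Type*} [MetricSpace X] [MeasurableSpace X] (p : ℝ)
    (μ : Measure X) (f : X → ℝ) (g : X → ℝ≥0∞) : Prop :=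
  IsSobolevUpperGradient p μ f g ∧ ∀ h, IsSobolevUpperGradient p μ f h → g ≤ᵐ[μ] h

/-! ### Existence of the minimal weak upper gradient -/

section Existence

theorem ac_of_le_lintegral {h : ℝ → ℝ} {G : ℝ → ℝ≥0∞} {a b : ℝ} (hab : a < b)
    (hm : AEMeasurable G (volume.restrict (Icc a b))) (hfin : ∫⁻ t in Icc a b, G t ≠ ∞)
    (hG : ∀ s t, a ≤ s → s < t → t ≤ b → edist (h s) (h t) ≤ ∫⁻ u in Icc s t, G u) :
    AbsolutelyContinuousOnInterval h a b ∧
      ∀ᵐ t ∂(volume.restrict (Icc a b)), ‖deriv h t‖ₑ ≤ G t := by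
  set φ : ℝ → ℝ := fun t => (G t).toReal with hφ
  have hint : IntegrableOn φ (Icc a b) := integrable_toReal_of_lintegral_ne_top hm hfin
  have hII : IntervalIntegrable φ volume a b := by
    rw [intervalIntegrable_iff_integrableOn_Icc_of_le hab.le]; exact hint
  set P : ℝ → ℝ := fun t => ∫ u in a..t, φ u with hP
  have hsub : ∀ s t, a ≤ s → s < t → t ≤ b → |h t - h s| ≤ P t - P s := by
    intro s t has hst htb
    have hIs : ∀ c ∈ Icc a b, IntervalIntegrable φ volume a c := fun c hc =>
      hII.mono_set (by rw [uIcc_of_le hc.1, uIcc_of_le hab.le]; exact Icc_subset_Icc_right hc.2)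
    have hPs : P t - P s = ∫ u in s..t, φ u :=
      intervalIntegral.integral_interval_sub_left (hIs t ⟨has.trans hst.le, htb⟩)
        (hIs s ⟨has, hst.le.trans htb⟩)
    have hss : Icc s t ⊆ Icc a b := Icc_subset_Icc has htb
    have hfin' : ∫⁻ u in Icc s t, G u ≠ ∞ := ne_top_of_le_ne_top hfin (lintegral_mono_set hss)
    have hm' : AEMeasurable G (volume.restrict (Icc s t)) := hm.mono_set hss
    have h1 : ∫ u in s..t, φ u = (∫⁻ u in Icc s t, G u).toReal := by
      rw [intervalIntegral.integral_of_le hst.le, ← integral_Icc_eq_integral_Ioc,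
        integral_toReal hm' (ae_lt_top' hm' hfin')]
    rw [hPs, h1, abs_sub_comm, ← Real.dist_eq, ← ENNReal.ofReal_le_iff_le_toReal hfin',
      ← edist_dist]
    exact hG s t has hst htb
  have hsub' : ∀ s ∈ Icc a b, ∀ t ∈ Icc a b, dist (h s) (h t) ≤ dist (P s) (P t) := by
    intro s hs t ht
    rcases lt_trichotomy s t with hst | rfl | hst
    · rw [dist_comm, dist_comm (P s), Real.dist_eq, Real.dist_eq]
      exact (hsub s t hs.1 hst ht.2).trans (le_abs_self _)
    · simp
    · rw [Real.dist_eq, Real.dist_eq]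
      exact (hsub t s ht.1 hst hs.2).trans (le_abs_self _)
  have hPac : AbsolutelyContinuousOnInterval P a b :=
    hII.absolutelyContinuousOnInterval_intervalIntegral (by simp)
  have hac : AbsolutelyContinuousOnInterval h a b := by
    rw [absolutelyContinuousOnInterval_iff] at hPac ⊢
    intro ε hε
    obtain ⟨δ, hδ, H⟩ := hPac ε hε
    refine ⟨δ, hδ, fun E hE hEδ => lt_of_le_of_lt (Finset.sum_le_sum fun i hi => ?_) (H E hE hEδ)⟩
    have := hE.1 i hi
    rw [uIcc_of_le hab.le] at this
    exact hsub' _ this.1 _ this.2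
  refine ⟨hac, ?_⟩
  rw [← Measure.restrict_congr_set (Ioo_ae_eq_Icc (a := a) (b := b)),
    ae_restrict_iff' measurableSet_Ioo]
  filter_upwards [hac.ae_differentiableAt, hII.ae_hasDerivAt_integral] with x hx1 hx2 hx
  have hx' : x ∈ uIcc a b := by rw [uIcc_of_le hab.le]; exact Ioo_subset_Icc_self hx
  have d1 := (hx1 hx').hasDerivAt
  have d2 : HasDerivAt P (φ x) x := hx2 hx' a (by simp)
  have t1 := (hasDerivAt_iff_tendsto_slope.1 d1).abs.mono_left
    (show 𝓝[>] x ≤ 𝓝[≠] x from nhdsWithin_mono x fun y hy => ne_of_gt hy)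
  have t2 := (hasDerivAt_iff_tendsto_slope.1 d2).mono_left
    (show 𝓝[>] x ≤ 𝓝[≠] x from nhdsWithin_mono x fun y hy => ne_of_gt hy)
  have hle : |deriv h x| ≤ φ x := by
    refine le_of_tendsto_of_tendsto t1 t2 ?_
    filter_upwards [Ioo_mem_nhdsGT hx.2] with y hy
    rw [slope_def_field, slope_def_field, abs_div, abs_of_pos (sub_pos.2 hy.1)]
    exact div_le_div_of_nonneg_right (hsub x y hx.1.le hy.1 hy.2.le) (sub_pos.2 hy.1).le
  rw [Real.enorm_eq_ofReal_abs]
  exact (ENNReal.ofReal_le_ofReal hle).trans ENNReal.ofReal_toReal_le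

theorem edist_le_lintegral_min {h : ℝ → ℝ} {G₁ G₂ : ℝ → ℝ≥0∞} {a b : ℝ} (hab : a < b)
    (hm₁ : AEMeasurable G₁ (volume.restrict (Icc a b))) (hfin₁ : ∫⁻ t in Icc a b, G₁ t ≠ ∞)
    (hG₁ : ∀ s t, a ≤ s → s < t → t ≤ b → edist (h s) (h t) ≤ ∫⁻ u in Icc s t, G₁ u)
    (hm₂ : AEMeasurable G₂ (volume.restrict (Icc a b))) (hfin₂ : ∫⁻ t in Icc a b, G₂ t ≠ ∞)
    (hG₂ : ∀ s t, a ≤ s → s < t → t ≤ b → edist (h s) (h t) ≤ ∫⁻ u in Icc s t, G₂ u) :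
    edist (h a) (h b) ≤ ∫⁻ t in Icc a b, min (G₁ t) (G₂ t) := by
  obtain ⟨hac, h1⟩ := ac_of_le_lintegral hab hm₁ hfin₁ hG₁
  obtain ⟨-, h2⟩ := ac_of_le_lintegral hab hm₂ hfin₂ hG₂
  rw [edist_comm, edist_eq_enorm_sub, ← hac.integral_deriv_eq_sub,
    intervalIntegral.integral_of_le hab.le, ← integral_Icc_eq_integral_Ioc]
  refine (enorm_integral_le_lintegral_enorm _).trans (lintegral_mono_ae ?_)
  filter_upwards [h1, h2] with t a1 a2 using le_min a1 a2

variable {X : Type*} [MetricSpace X]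

theorem RectCurve.continuousOn (γ : RectCurve X) : ContinuousOn γ.toFun (Icc γ.a γ.b) := by
  have : LipschitzOnWith 1 γ.toFun (Icc γ.a γ.b) := by
    intro x hx y hy
    wlog hxy : x ≤ y generalizing x y
    · rw [edist_comm, edist_comm x]; exact this hy hx (le_of_not_ge hxy)
    refine (eVariationOn.edist_le γ.toFun (s := Icc γ.a γ.b ∩ Icc x y)
      ⟨hx, le_rfl, hxy⟩ ⟨hy, hxy, le_rfl⟩).trans ?_
    rw [γ.unitSpeed hx hy, edist_dist, dist_comm, Real.dist_eq, abs_of_nonneg (sub_nonneg.2 hxy)]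
    simp
  exact this.continuousOn

/-- The subcurve on `[s, t]`. -/
def RectCurve.sub (γ : RectCurve X) (s t : ℝ) (hs : γ.a ≤ s) (hst : s < t) (ht : t ≤ γ.b) :
    RectCurve X where
  a := s
  b := t
  lt := hst
  toFun := γ.toFun
  unitSpeed := by
    intro x hx y hy
    have h1 : Icc s t ∩ Icc x y = Icc γ.a γ.b ∩ Icc x y := by
      rw [inter_eq_right.2 (Icc_subset_Icc hx.1 hy.2),
        inter_eq_right.2 (Icc_subset_Icc (hs.trans hx.1) (hy.2.trans ht))]
    rw [h1]
    exact γ.unitSpeed ⟨hs.trans hx.1, hx.2.trans ht⟩ ⟨hs.trans hy.1, hy.2.trans ht⟩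

theorem RectCurve.aemeasurable_comp [MeasurableSpace X] [BorelSpace X] (γ : RectCurve X)
    {g : X → ℝ≥0∞} (hg : Measurable g) :
    AEMeasurable (fun t => g (γ.toFun t)) (volume.restrict (Icc γ.a γ.b)) :=
  hg.comp_aemeasurable (γ.continuousOn.aemeasurable measurableSet_Icc)

variable [MeasurableSpace X] {p : ℝ} {μ : Measure X}

theorem modulus_mono {Γ Γ' : Set (RectCurve X)} (h : Γ ⊆ Γ') :
    modulus p μ Γ ≤ modulus p μ Γ' :=
  le_iInf₂ fun ρ hρ => iInf₂_le ρ ⟨hρ.1, fun γ hγ => hρ.2 γ (h hγ)⟩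

theorem modulus_null_mono {Γ Γ' : Set (RectCurve X)} (h : Γ ⊆ Γ') (h0 : modulus p μ Γ' = 0) :
    modulus p μ Γ = 0 :=
  le_antisymm ((modulus_mono h).trans h0.le) bot_le

theorem modulus_iUnion_null {ι : Type} [Countable ι] (hp : 0 < p) {Γ : ι → Set (RectCurve X)}
    (h : ∀ n, modulus p μ (Γ n) = 0) : modulus p μ (⋃ n, Γ n) = 0 := by
  refine le_antisymm (le_of_forall_gt fun ε hε => ?_) bot_le
  obtain ⟨δ, hδ, hsum⟩ := ENNReal.exists_pos_sum_of_countable' hε.ne' ι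
  have : ∀ n, ∃ ρ : X → ℝ≥0∞, (Measurable ρ ∧ ∀ γ ∈ Γ n, 1 ≤ γ.lineIntegral ρ) ∧
      ∫⁻ x, ρ x ^ p ∂μ < δ n := by
    intro n
    have h1 : modulus p μ (Γ n) < δ n := by rw [h n]; exact hδ n
    simpa only [modulus, iInf_lt_iff, exists_prop] using h1
  choose ρ hρ hρδ using this
  refine lt_of_le_of_lt ?_ hsum
  refine (iInf₂_le (fun x => ⨆ n, ρ n x) ⟨Measurable.iSup fun n => (hρ n).1, ?_⟩).trans ?_
  swap
  · intro γ hγ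
    obtain ⟨n, hn⟩ := mem_iUnion.1 hγ
    exact ((hρ n).2 γ hn).trans (lintegral_mono fun t => le_iSup (fun n => ρ n (γ.toFun t)) n)
  · calc ∫⁻ x, (⨆ n, ρ n x) ^ p ∂μ ≤ ∫⁻ x, ∑' n, ρ n x ^ p ∂μ := by
          refine lintegral_mono fun x => ?_
          have := (ENNReal.orderIsoRpow p hp).map_iSup (fun n => ρ n x)
          simp only [ENNReal.orderIsoRpow_apply] at this
          rw [this]
          exact iSup_le fun n => ENNReal.le_tsum n
      _ = ∑' n, ∫⁻ x, ρ n x ^ p ∂μ :=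
          lintegral_tsum fun n => ((hρ n).1.pow_const p).aemeasurable
      _ ≤ ∑' n, δ n := ENNReal.tsum_le_tsum fun n => (hρδ n).le

theorem modulus_union_null (hp : 0 < p) {Γ Γ' : Set (RectCurve X)}
    (h : modulus p μ Γ = 0) (h' : modulus p μ Γ' = 0) : modulus p μ (Γ ∪ Γ') = 0 := by
  rw [union_eq_iUnion]
  exact modulus_iUnion_null hp fun b => by cases b <;> simpa

theorem modulus_lineIntegral_top (hp : 0 < p) {ρ : X → ℝ≥0∞} (hρ : Measurable ρ)
    (hfin : ∫⁻ x, ρ x ^ p ∂μ < ∞) : modulus p μ {γ | γ.lineIntegral ρ = ∞} = 0 := by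
  have key : ∀ n : ℕ, modulus p μ {γ | γ.lineIntegral ρ = ∞} ≤
      ((n : ℝ≥0∞)⁻¹) ^ p * ∫⁻ x, ρ x ^ p ∂μ := by
    intro n
    refine (iInf₂_le (fun x => (n : ℝ≥0∞)⁻¹ * ρ x) ⟨hρ.const_mul _, ?_⟩).trans ?_
    swap
    · intro γ hγ
      have hγ' : ∫⁻ t in Icc γ.a γ.b, ρ (γ.toFun t) = ∞ := hγ
      refine le_trans ?_ (lintegral_const_mul_le ((n : ℝ≥0∞)⁻¹) _)
      rw [hγ', ENNReal.mul_top (by simp)]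
      exact le_top
    · rw [← lintegral_const_mul _ (hρ.pow_const p)]
      exact lintegral_mono fun x => (ENNReal.mul_rpow_of_nonneg _ _ hp.le).le
  have ht : Tendsto (fun n : ℕ => ((n : ℝ≥0∞)⁻¹) ^ p * ∫⁻ x, ρ x ^ p ∂μ) atTop (𝓝 0) := by
    have h1 : Tendsto (fun n : ℕ => ((n : ℝ≥0∞)⁻¹) ^ p) atTop (𝓝 0) := by
      have := (ENNReal.continuous_rpow_const (y := p)).tendsto 0
      rw [ENNReal.zero_rpow_of_pos hp] at this
      exact this.comp ENNReal.tendsto_inv_nat_nhds_zero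
    simpa using ENNReal.Tendsto.mul_const h1 (Or.inr hfin.ne)
  exact le_antisymm (ge_of_tendsto' ht key) bot_le

theorem modulus_sub_null {Γ : Set (RectCurve X)} (h : modulus p μ Γ = 0) :
    modulus p μ {γ | ∃ s t hs hst ht, γ.sub s t hs hst ht ∈ Γ} = 0 := by
  refine le_antisymm (le_trans ?_ h.le) bot_le
  refine le_iInf₂ fun ρ hρ => iInf₂_le ρ ⟨hρ.1, ?_⟩
  rintro γ ⟨s, t, hs, hst, ht, hγ⟩
  exact (hρ.2 _ hγ).trans (lintegral_mono_set (Icc_subset_Icc hs ht))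

/-- Along almost every curve the upper gradient inequality holds on all subcurves and the upper
gradient has finite integral. -/
theorem IsWeakUpperGradient.modulus_bad (hp : 0 < p) {f : X → ℝ} {g : X → ℝ≥0∞}
    (hg : IsWeakUpperGradient p μ f g) (hfin : ∫⁻ x, g x ^ p ∂μ < ∞) :
    modulus p μ {γ | ¬ (γ.lineIntegral g ≠ ∞ ∧ ∀ s t, γ.a ≤ s → s < t → t ≤ γ.b →
      edist (f (γ.toFun s)) (f (γ.toFun t)) ≤ ∫⁻ u in Icc s t, g (γ.toFun u))} = 0 := by
  refine modulus_null_mono ?_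
    (modulus_union_null hp (modulus_lineIntegral_top hp hg.1 hfin) (modulus_sub_null hg.2))
  intro γ hγ
  by_contra hcon
  simp only [mem_union, mem_ofPred_eq, not_or] at hcon
  refine hγ ⟨hcon.1, fun s t hs hst ht => ?_⟩
  by_contra hb
  exact hcon.2 ⟨s, t, hs, hst, ht, hb⟩

variable [BorelSpace X]

theorem IsWeakUpperGradient.min (hp : 0 < p) {f : X → ℝ} {g₁ g₂ : X → ℝ≥0∞}
    (h₁ : IsWeakUpperGradient p μ f g₁) (hf₁ : ∫⁻ x, g₁ x ^ p ∂μ < ∞)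
    (h₂ : IsWeakUpperGradient p μ f g₂) (hf₂ : ∫⁻ x, g₂ x ^ p ∂μ < ∞) :
    IsWeakUpperGradient p μ f (fun x => Min.min (g₁ x) (g₂ x)) := by
  refine ⟨h₁.1.min h₂.1, modulus_null_mono ?_
    (modulus_union_null hp (h₁.modulus_bad hp hf₁) (h₂.modulus_bad hp hf₂))⟩
  intro γ hγ
  by_contra hcon
  simp only [mem_union, mem_ofPred_eq, not_or, not_not] at hcon
  obtain ⟨⟨a1, b1⟩, a2, b2⟩ := hcon
  exact hγ (edist_le_lintegral_min (h := fun t => f (γ.toFun t)) γ.lt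
    (γ.aemeasurable_comp h₁.1) a1 b1 (γ.aemeasurable_comp h₂.1) a2 b2)

theorem IsWeakUpperGradient.congr_rep (hp : 0 < p) {f₁ f₂ : X → ℝ} (hff : f₁ =ᵐ[μ] f₂)
    {g₁ g₂ : X → ℝ≥0∞}
    (h₁ : IsWeakUpperGradient p μ f₁ g₁) (hf₁ : ∫⁻ x, g₁ x ^ p ∂μ < ∞)
    (h₂ : IsWeakUpperGradient p μ f₂ g₂) (hf₂ : ∫⁻ x, g₂ x ^ p ∂μ < ∞) :
    IsWeakUpperGradient p μ f₁ g₂ := by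
  set N : Set X := toMeasurable μ {x | f₁ x ≠ f₂ x} with hN
  have hNm : MeasurableSet N := measurableSet_toMeasurable _ _
  have hN0 : μ N = 0 := by rw [hN, measure_toMeasurable]; exact hff
  set ρ : X → ℝ≥0∞ := N.indicator (fun _ => ∞) with hρ
  have hρm : Measurable ρ := measurable_const.indicator hNm
  have hρ0 : ∫⁻ x, ρ x ^ p ∂μ < ∞ := by
    have : (fun x => ρ x ^ p) =ᵐ[μ] fun _ => 0 := by
      filter_upwards [measure_eq_zero_iff_ae_notMem.1 hN0] with x hx
      simp [hρ, hx, hp]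
    rw [lintegral_congr_ae this]; simp
  refine ⟨h₂.1, modulus_null_mono ?_ (modulus_union_null hp (modulus_union_null hp
    (h₁.modulus_bad hp hf₁) (h₂.modulus_bad hp hf₂)) (modulus_lineIntegral_top hp hρm hρ0))⟩
  intro γ hγ
  by_contra hcon
  simp only [mem_union, mem_ofPred_eq, not_or, not_not] at hcon
  obtain ⟨⟨⟨a1, b1⟩, a2, b2⟩, c⟩ := hcon
  have cont1 := (ac_of_le_lintegral (h := fun t => f₁ (γ.toFun t)) γ.lt
    (γ.aemeasurable_comp h₁.1) a1 b1).1.continuousOn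
  have cont2 := (ac_of_le_lintegral (h := fun t => f₂ (γ.toFun t)) γ.lt
    (γ.aemeasurable_comp h₂.1) a2 b2).1.continuousOn
  rw [uIcc_of_le γ.lt.le] at cont1 cont2
  have hae : (fun t => f₁ (γ.toFun t)) =ᵐ[volume.restrict (Icc γ.a γ.b)]
      fun t => f₂ (γ.toFun t) := by
    filter_upwards [ae_lt_top' (γ.aemeasurable_comp hρm) c] with t ht
    by_contra hne
    have : γ.toFun t ∈ N := subset_toMeasurable _ _ hne
    simp [hρ, this] at ht
  have heq := Measure.eqOn_Icc_of_ae_eq volume γ.lt.ne hae cont1 cont2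
  have ea := heq (left_mem_Icc.2 γ.lt.le)
  have eb := heq (right_mem_Icc.2 γ.lt.le)
  simp only at ea eb
  apply hγ
  rw [ea, eb]
  exact b2 _ _ le_rfl γ.lt le_rfl

theorem IsWeakUpperGradient.iInf (hp : 0 < p) {f : X → ℝ} {g : ℕ → X → ℝ≥0∞}
    (h : ∀ n, IsWeakUpperGradient p μ f (g n)) (hanti : Antitone g)
    (hfin : ∫⁻ x, g 0 x ^ p ∂μ < ∞) :
    IsWeakUpperGradient p μ f (fun x => ⨅ n, g n x) := by
  refine ⟨Measurable.iInf fun n => (h n).1, modulus_null_mono ?_ (modulus_union_null hp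
    (modulus_iUnion_null hp fun n => (h n).2) (modulus_lineIntegral_top hp (h 0).1 hfin))⟩
  intro γ hγ
  by_contra hcon
  simp only [mem_union, mem_iUnion, mem_ofPred_eq, not_or, not_exists, not_not] at hcon
  apply hγ
  have : γ.lineIntegral (fun x => ⨅ n, g n x) = ⨅ n, γ.lineIntegral (g n) :=
    lintegral_iInf' (fun n => γ.aemeasurable_comp (h n).1)
      (ae_of_all _ fun t m n hmn => hanti hmn _) hcon.2
  rw [this]
  exact le_iInf hcon.1

theorem IsSobolevUpperGradient.min (hp : 0 < p) {f : X → ℝ} {g₁ g₂ : X → ℝ≥0∞}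
    (h₁ : IsSobolevUpperGradient p μ f g₁) (h₂ : IsSobolevUpperGradient p μ f g₂) :
    IsSobolevUpperGradient p μ f (fun x => Min.min (g₁ x) (g₂ x)) := by
  obtain ⟨i₁, f₁, e₁, w₁⟩ := h₁
  obtain ⟨i₂, f₂, e₂, w₂⟩ := h₂
  refine ⟨lt_of_le_of_lt (lintegral_mono fun x => ?_) i₁, f₁, e₁,
    w₁.min hp i₁ (w₁.congr_rep hp (e₁.trans e₂.symm) i₁ w₂ i₂) i₂⟩
  exact ENNReal.rpow_le_rpow (min_le_left _ _) hp.le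

/-- Every function with a `p`-integrable `p`-weak upper gradient has a minimal one. -/
theorem exists_isMinimalUpperGradient (hp : 0 < p) {f : X → ℝ}
    (hf : ∃ g, IsSobolevUpperGradient p μ f g) : ∃ g, IsMinimalUpperGradient p μ f g := by
  set S : Set ℝ≥0∞ := (fun g : X → ℝ≥0∞ => ∫⁻ x, g x ^ p ∂μ) ''
    {g | IsSobolevUpperGradient p μ f g} with hS
  have hne : S.Nonempty := by
    obtain ⟨g, hg⟩ := hf
    exact ⟨_, g, hg, rfl⟩
  obtain ⟨v, -, hv, hvS⟩ := exists_seq_tendsto_sInf hne (OrderBot.bddBelow S)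
  choose u hu huv using hvS
  let g : ℕ → X → ℝ≥0∞ := fun n => Nat.rec (u 0) (fun k G x => Min.min (G x) (u (k + 1) x)) n
  have hgs : ∀ n, IsSobolevUpperGradient p μ f (g n) := by
    intro n
    induction n with
    | zero => exact hu 0
    | succ k ih => exact ih.min hp (hu (k + 1))
  have hanti : Antitone g := antitone_nat_of_succ_le fun n x => min_le_left _ _
  have hgu : ∀ n x, g n x ≤ u n x := by
    intro n x
    cases n with
    | zero => exact le_rfl
    | succ k => exact min_le_right _ _
  set G : X → ℝ≥0∞ := fun x => ⨅ n, g n x with hG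
  have hGle : ∀ n, ∫⁻ x, G x ^ p ∂μ ≤ v n := by
    intro n
    rw [← huv n]
    exact lintegral_mono fun x =>
      ENNReal.rpow_le_rpow ((iInf_le (fun n => g n x) n).trans (hgu n x)) hp.le
  have hGinf : ∫⁻ x, G x ^ p ∂μ ≤ sInf S := ge_of_tendsto' hv hGle
  have hGs : IsSobolevUpperGradient p μ f G := by
    obtain ⟨i₀, f₀, e₀, w₀⟩ := hgs 0
    refine ⟨lt_of_le_of_lt (lintegral_mono fun x =>
      ENNReal.rpow_le_rpow (iInf_le (fun n => g n x) 0) hp.le) i₀, f₀, e₀,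
      IsWeakUpperGradient.iInf hp (fun n => ?_) hanti i₀⟩
    obtain ⟨i, f', e, w⟩ := hgs n
    exact w₀.congr_rep hp (e₀.trans e.symm) i₀ w i
  refine ⟨G, hGs, fun h hh => ?_⟩
  have hm := hGs.min hp hh
  have hle : ∫⁻ x, G x ^ p ∂μ ≤ ∫⁻ x, Min.min (G x) (h x) ^ p ∂μ :=
    hGinf.trans (sInf_le ⟨_, hm, rfl⟩)
  obtain ⟨iG, fG, eG, wG⟩ := hGs
  have hae := ae_eq_of_ae_le_of_lintegral_le
    (ae_of_all μ fun x => ENNReal.rpow_le_rpow (min_le_left (G x) (h x)) hp.le)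
    hm.1.ne (wG.1.pow_const p).aemeasurable hle
  filter_upwards [hae] with x hx
  exact min_eq_left_iff.1 (ENNReal.rpow_left_injective hp.ne' hx)

end Existence

/-- The minimal `p`-weak upper gradient `|Df|_{p,w}` of `f ∈ W^{1,p}(X)` (it exists by
`exists_isMinimalUpperGradient` and is unique up to null sets; outside `W^{1,p}(X)` the value is
irrelevant). -/
def minimalUpperGradient {X : Type*} [MetricSpace X] [MeasurableSpace X] (p : ℝ)
    (μ : Measure X) (f : X → ℝ) : X → ℝ≥0∞ :=
  open Classical in
  if h : ∃ g, IsMinimalUpperGradient p μ f g then h.choose else 0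

theorem isMinimalUpperGradient_minimalUpperGradient {X : Type*} [MetricSpace X]
    [MeasurableSpace X] [BorelSpace X] {p : ℝ} (hp : 0 < p) {μ : Measure X} {f : X → ℝ}
    (hf : MemSobolev p μ f) : IsMinimalUpperGradient p μ f (minimalUpperGradient p μ f) := by
  have h := exists_isMinimalUpperGradient hp hf.2
  rw [minimalUpperGradient, dif_pos h]
  exact h.choose_spec

/-- The spectral gap `λ₁(X)` of a metric measure space of finite measure, as an element of
`[0, ∞]`; the infimum of the empty set (for a one-point space, say) is `∞`. -/
def spectralGap {X : Type*} [MetricSpace X] [MeasurableSpace X] (μ : Measure X) : ℝ≥0∞ :=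
  ⨅ (u : X → ℝ) (_ : MemSobolev 2 μ u ∧ ∫ x, u x ∂μ = 0 ∧ ∫ x, u x ^ 2 ∂μ = 1),
    ∫⁻ x, minimalUpperGradient 2 μ u x ^ 2 ∂μ

end MMS

end

/-! After truncation let `f` be a bounded nonnegative Sobolev function. Up to a small error in
`L^p`, enlarge a weak upper gradient of `f` to a lower semicontinuous upper gradient `H` with
compact sublevel sets; up to a small error in `L^1`, enlarge `f` to a lower semicontinuous `F`.
Isometrically embed `X` in a Banach space, extend `F` and `H` by `∞`, and consider the optimal
stopping problem with running cost `H` and terminal cost `F`. As `H` is an upper gradient, its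
value function lies between `f` and `F`. If `H` is replaced by its `n`-Lipschitz regularization
the value function becomes Lipschitz, with slope at most `H` on `X` because nearby points can be
joined by segments of the ambient space; and as `n → ∞` these value functions increase to the
original one, since the sublevel sets of `H` force almost optimal curves to stay in a common
compact set.

For bounded Lipschitz `v` the `(p,p)`-inequality is the `(1,1)`-inequality for the signed `p`-th
power of `v - c`, with `c` chosen so that this power has mean zero, followed by Hölder's
inequality. It passes to limits because the `p`-oscillation, written as a double integral, is
lower semicontinuous under pointwise convergence. -/

namespace MMS

section LipschitzRegularization

variable {E : Type*} [PseudoEMetricSpace E] {H : E → ℝ≥0∞}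

/-- The Lipschitz regularization of `min H n` from below: its largest `n`-Lipschitz minorant. -/
noncomputable def lipReg (H : E → ℝ≥0∞) (n : ℕ) (x : E) : ℝ≥0∞ :=
  ⨅ y, (min (H y) n + n * edist x y)

theorem lipReg_le_add (n : ℕ) (x y : E) : lipReg H n x ≤ lipReg H n y + n * edist x y := by
  rw [lipReg, lipReg, ENNReal.iInf_add]
  refine le_iInf fun z => (iInf_le _ z).trans ?_
  rw [add_assoc, ← mul_add, add_comm (edist y z)]
  gcongr
  exact edist_triangle x y z

theorem continuous_lipReg (n : ℕ) : Continuous (lipReg H n) :=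
  continuous_of_le_add_edist n (ENNReal.natCast_ne_top n) fun x y => lipReg_le_add n x y

theorem lipReg_le_self (n : ℕ) (x : E) : lipReg H n x ≤ H x :=
  (iInf_le _ x).trans (by simp)

theorem lipReg_le_natCast (n : ℕ) (x : E) : lipReg H n x ≤ n :=
  (iInf_le _ x).trans (by simp)

theorem lipReg_mono {m n : ℕ} (h : m ≤ n) (x : E) : lipReg H m x ≤ lipReg H n x :=
  iInf_mono fun y => by gcongr

theorem le_lipReg {n : ℕ} {x : E} {a r : ℝ≥0∞} (h : ∀ y, edist x y < r → a ≤ H y) (han : a ≤ n)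
    (hr : a ≤ n * r) : a ≤ lipReg H n x := by
  refine le_iInf fun y => ?_
  rcases lt_or_ge (edist x y) r with hy | hy
  · exact (le_min (h y hy) han).trans le_self_add
  · exact (hr.trans (by gcongr)).trans le_add_self

theorem le_lipReg_of_forall_le {n : ℕ} {a : ℝ≥0∞} (h : ∀ y, a ≤ H y) (han : a ≤ n) (x : E) :
    a ≤ lipReg H n x :=
  le_iInf fun y => (le_min (h y) han).trans le_self_add

theorem eventually_lt_lipReg (hH : LowerSemicontinuous H) {x : E} {a : ℝ≥0∞} (ha : a < H x) :
    ∀ᶠ n in atTop, a < lipReg H n x := by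
  obtain ⟨b, hab, hb⟩ := exists_between ha
  obtain ⟨r, hr, hball⟩ := EMetric.mem_nhds_iff.1 (hH x b hb)
  obtain ⟨n₁, hn₁⟩ := ENNReal.exists_nat_gt hb.ne_top
  obtain ⟨n₂, hn₂⟩ := ENNReal.exists_nat_mul_gt hr.ne' hb.ne_top
  filter_upwards [eventually_ge_atTop n₁, eventually_ge_atTop n₂] with n h₁ h₂
  refine hab.trans_le (le_lipReg (r := r) (fun y hy => ?_) ?_ ?_)
  · exact (hball (by rwa [Metric.mem_eball, edist_comm])).le
  · exact hn₁.le.trans (by exact_mod_cast h₁)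
  · exact hn₂.le.trans (by gcongr)

theorem le_liminf_lipReg (hH : LowerSemicontinuous H) {ι : Type*} {l : Filter ι} {k : ι → ℕ}
    (hk : Tendsto k l atTop) {y : ι → E} {x : E} (hy : Tendsto y l (𝓝 x)) :
    H x ≤ liminf (fun i => lipReg H (k i) (y i)) l := by
  refine le_of_forall_lt fun a ha => ?_
  obtain ⟨b, hab, hb⟩ := exists_between ha
  obtain ⟨n, hn⟩ := (eventually_lt_lipReg hH hb).exists
  refine hab.trans_le (le_liminf_of_le isCobounded_ge_of_top ?_)
  filter_upwards [hk.eventually_ge_atTop n,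
    hy.eventually ((continuous_lipReg n).continuousAt.eventually_const_lt hn)] with i hki hyi
  exact hyi.le.trans (lipReg_mono hki _)

end LipschitzRegularization

section ValueFunction

variable {E : Type*} {F G : E → ℝ≥0∞} {c : ℝ → E} {T : ℝ} {x y : E}

/-- The cost of running along the curve `c` during the time `[0, T]` with running cost `G` and
stopping at `c T` with terminal cost `F`. -/
noncomputable def cost (F G : E → ℝ≥0∞) (c : ℝ → E) (T : ℝ) : ℝ≥0∞ :=
  F (c T) + ∫⁻ t in Icc 0 T, G (c t)

variable [PseudoEMetricSpace E]

/-- The value function of the optimal stopping problem with running cost `G` and terminal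
cost `F`: the least cost of a curve of speed at most `1` that starts at `x`. -/
noncomputable def valueFun (F G : E → ℝ≥0∞) (x : E) : ℝ≥0∞ :=
  ⨅ (c : ℝ → E) (T : ℝ) (_ : LipschitzWith 1 c ∧ c 0 = x ∧ 0 ≤ T), cost F G c T

theorem valueFun_le_cost (hc : LipschitzWith 1 c) (hT : 0 ≤ T) :
    valueFun F G (c 0) ≤ cost F G c T :=
  iInf₂_le_of_le c T (iInf_le _ ⟨hc, rfl, hT⟩)

theorem valueFun_le_self (x : E) : valueFun F G x ≤ F x := by
  simpa [cost] using valueFun_le_cost (F := F) (G := G) (LipschitzWith.const' x) (le_refl 0)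

theorem valueFun_mono {G' : E → ℝ≥0∞} (h : G ≤ G') (x : E) :
    valueFun F G x ≤ valueFun F G' x := by
  unfold valueFun cost
  gcongr
  exact h _

theorem exists_cost_lt_of_valueFun_lt {a : ℝ≥0∞} (h : valueFun F G x < a) :
    ∃ (c : ℝ → E) (T : ℝ), LipschitzWith 1 c ∧ c 0 = x ∧ 0 ≤ T ∧ cost F G c T < a := by
  simpa only [valueFun, iInf_lt_iff, exists_prop, and_assoc] using h

end ValueFunction

section PrependSegment

variable {E : Type*} [NormedAddCommGroup E] [NormedSpace ℝ E] {F G : E → ℝ≥0∞} {c : ℝ → E} {T : ℝ}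
  {x y : E}

/-- The curve that runs with unit speed along the segment from `y` to `c 0` and then follows `c`.
If `y = c 0` it is `c`, the quotient `0 / 0` being multiplied by `y - c 0 = 0`. -/
noncomputable def prependSegment (y : E) (c : ℝ → E) (t : ℝ) : E :=
  c (max (t - dist y (c 0)) 0) + (1 - min t (dist y (c 0)) / dist y (c 0)) • (y - c 0)

theorem prependSegment_zero (y : E) (c : ℝ → E) : prependSegment y c 0 = y := by
  simp [prependSegment]

theorem prependSegment_of_le {t : ℝ} (ht : dist y (c 0) ≤ t) :
    prependSegment y c t = c (t - dist y (c 0)) := by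
  rcases eq_or_ne y (c 0) with hy | hy
  · rw [prependSegment, max_eq_left (sub_nonneg.2 ht), sub_eq_zero_of_eq hy, smul_zero, add_zero]
  · rw [prependSegment, max_eq_left (sub_nonneg.2 ht), min_eq_right ht,
      div_self (dist_ne_zero.2 hy), sub_self, zero_smul, add_zero]

theorem prependSegment_mem_segment {t : ℝ} (ht : t ∈ Icc 0 (dist y (c 0))) :
    prependSegment y c t ∈ segment ℝ (c 0) y := by
  rw [segment_eq_image', prependSegment, max_eq_right (sub_nonpos.2 ht.2), min_eq_left ht.2]
  exact ⟨_, ⟨sub_nonneg.2 (div_le_one_of_le₀ ht.2 dist_nonneg),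
    sub_le_self _ (div_nonneg ht.1 dist_nonneg)⟩, rfl⟩

theorem lipschitzWith_prependSegment (hc : LipschitzWith 1 c) (y : E) :
    LipschitzWith 1 (prependSegment y c) := by
  refine LipschitzWith.of_dist_le_mul fun t u => ?_
  wlog htu : t ≤ u generalizing t u
  · simpa only [dist_comm] using this u t (le_of_not_ge htu)
  set d := dist y (c 0) with hd
  have hmin : min t d ≤ min u d := min_le_min_right d htu
  have hmax : max (t - d) 0 ≤ max (u - d) 0 := max_le_max_right 0 (sub_le_sub_right htu d)
  have hsum : ∀ s, max (s - d) 0 + min s d = s := fun s => by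
    rcases le_total s d with h | h <;> simp [h]
  have hcurve : dist (c (max (t - d) 0)) (c (max (u - d) 0)) ≤ max (u - d) 0 - max (t - d) 0 := by
    refine (hc.dist_le_mul _ _).trans_eq ?_
    rw [NNReal.coe_one, one_mul, dist_comm, Real.dist_eq, abs_of_nonneg (sub_nonneg.2 hmax)]
  have hsegment : dist ((1 - min t d / d) • (y - c 0)) ((1 - min u d / d) • (y - c 0)) ≤
      min u d - min t d := by
    rw [dist_eq_norm, ← sub_smul, sub_sub_sub_cancel_left, ← sub_div, norm_smul, norm_div,
      ← dist_eq_norm y, ← hd, Real.norm_of_nonneg (sub_nonneg.2 hmin),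
      Real.norm_of_nonneg dist_nonneg, div_mul_eq_mul_div]
    exact div_le_of_le_mul₀ dist_nonneg (sub_nonneg.2 hmin) le_rfl
  calc dist (prependSegment y c t) (prependSegment y c u)
      ≤ (max (u - d) 0 - max (t - d) 0) + (min u d - min t d) :=
        (dist_add_add_le _ _ _ _).trans (add_le_add hcurve hsegment)
    _ = u - t := by linarith [hsum t, hsum u]
    _ = (1 : ℝ≥0) * dist t u := by
        rw [dist_comm, Real.dist_eq, abs_of_nonneg (sub_nonneg.2 htu), NNReal.coe_one, one_mul]

theorem cost_prependSegment_le {B : ℝ≥0∞} (hB : ∀ z ∈ segment ℝ (c 0) y, G z ≤ B) (hT : 0 ≤ T) :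
    cost F G (prependSegment y c) (dist y (c 0) + T) ≤ cost F G c T + B * edist (c 0) y := by
  set d := dist y (c 0) with hd
  have hsegment : ∫⁻ t in Icc 0 d, G (prependSegment y c t) ≤ B * edist (c 0) y :=
    calc ∫⁻ t in Icc 0 d, G (prependSegment y c t) ≤ ∫⁻ _ in Icc 0 d, B :=
          setLIntegral_mono measurable_const fun t ht => hB _ (prependSegment_mem_segment ht)
      _ = B * edist (c 0) y := by
          rw [setLIntegral_const, Real.volume_Icc, sub_zero, hd, ← edist_dist, edist_comm]
  have hcurve : ∫⁻ t in Icc d (d + T), G (prependSegment y c t) = ∫⁻ t in Icc 0 T, G (c t) := by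
    rw [setLIntegral_congr_fun measurableSet_Icc fun t ht => by
        rw [prependSegment_of_le ht.1], ← lintegral_indicator measurableSet_Icc,
      ← lintegral_indicator measurableSet_Icc,
      ← lintegral_sub_right_eq_self ((Icc 0 T).indicator fun t => G (c t)) d]
    refine lintegral_congr fun t => ?_
    simp only [indicator, mem_Icc, sub_nonneg, sub_le_iff_le_add']
    rfl
  rw [cost, cost, prependSegment_of_le (by linarith), add_sub_cancel_left, add_assoc, ← hcurve,
    ← Icc_union_Icc_eq_Icc dist_nonneg (by linarith : d ≤ d + T)]
  gcongr
  exact (lintegral_union_le _ _ _).trans ((add_le_add_left hsegment _).trans_eq (add_comm _ _))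

theorem valueFun_le_add_mul_edist {B : ℝ≥0∞} (hB : ∀ z ∈ segment ℝ x y, G z ≤ B) :
    valueFun F G y ≤ valueFun F G x + B * edist x y := by
  conv_rhs => rw [valueFun]
  simp only [ENNReal.iInf_add]
  refine le_iInf₂ fun c T => le_iInf fun ⟨hc, hcx, hT⟩ => ?_
  subst hcx
  refine le_trans ?_ (cost_prependSegment_le hB hT)
  simpa only [prependSegment_zero] using
    valueFun_le_cost (lipschitzWith_prependSegment hc y) (add_nonneg dist_nonneg hT)

theorem edist_toReal_le {a b q : ℝ≥0∞} (ha : a ≠ ∞) (hb : b ≠ ∞) (hab : a ≤ b + q)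
    (hba : b ≤ a + q) : edist a.toReal b.toReal ≤ q := by
  rcases eq_or_ne q ∞ with rfl | hq
  · exact le_top
  rw [edist_dist, Real.dist_eq]
  refine ENNReal.ofReal_le_of_le_toReal (abs_sub_le_iff.2 ⟨?_, ?_⟩)
  · linarith [ENNReal.toReal_le_add hab hb hq]
  · linarith [ENNReal.toReal_le_add hba ha hq]

theorem edist_toReal_valueFun_le {B : ℝ≥0∞} (hx : valueFun F G x ≠ ∞) (hy : valueFun F G y ≠ ∞)
    (hB : ∀ z ∈ segment ℝ x y, G z ≤ B) :
    edist (valueFun F G x).toReal (valueFun F G y).toReal ≤ B * edist x y := by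
  refine edist_toReal_le hx hy ?_ (valueFun_le_add_mul_edist hB)
  rw [edist_comm]
  exact valueFun_le_add_mul_edist (by rwa [segment_symm])

variable {X : Type*} [MetricSpace X] {ι : X → E}

theorem lipschitzWith_toReal_valueFun {n : ℝ≥0} (hι : Isometry ι) (hG : ∀ z, G z ≤ n)
    (hV : ∀ y, valueFun F G (ι y) ≠ ∞) :
    LipschitzWith n fun y => (valueFun F G (ι y)).toReal := fun x y => by
  rw [← hι.edist_eq]
  exact edist_toReal_valueFun_le (hV x) (hV y) fun z _ => hG z

theorem slope_toReal_valueFun_le (hι : Isometry ι) (hV : ∀ y, valueFun F G (ι y) ≠ ∞) {x : X}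
    (hG : UpperSemicontinuousAt G (ι x)) :
    slope (fun y => (valueFun F G (ι y)).toReal) x ≤ G (ι x) := by
  refine le_of_forall_gt_imp_ge_of_dense fun B hB => limsup_le_of_le isCobounded_le_of_bot ?_
  obtain ⟨r, hr, hball⟩ := Metric.mem_nhds_iff.1 (hG B hB)
  refine eventually_nhdsWithin_of_eventually_nhds ?_
  filter_upwards [hι.continuous.continuousAt.preimage_mem_nhds (Metric.ball_mem_nhds _ hr)]
    with y hy
  refine ENNReal.div_le_of_le_mul ?_
  rw [← hι.edist_eq]
  exact edist_toReal_valueFun_le (hV x) (hV y) fun z hz =>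
    (hball ((convex_ball _ _).segment_subset (Metric.mem_ball_self hr) hy hz)).le

end PrependSegment

section LimitCurve

variable {E : Type*} [MetricSpace E] {F H : E → ℝ≥0∞}

theorem ennreal_le_liminf_add {ι : Type*} (l : Filter ι) (u v : ι → ℝ≥0∞) :
    liminf u l + liminf v l ≤ liminf (fun i => u i + v i) l := by
  simp only [liminf_eq, sSup_eq_iSup]
  refine ENNReal.biSup_add_biSup_le ⟨0, by simp⟩ ⟨0, by simp⟩ fun a ha b hb => ?_
  refine le_iSup₂_of_le (a + b) ?_ le_rfl
  filter_upwards [ha, hb] with i hai hbi using add_le_add hai hbi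

theorem totallyBounded_of_forall_exists_dist_lt {S : Set E}
    (h : ∀ ε > 0, ∃ K, TotallyBounded K ∧ ∀ x ∈ S, ∃ y ∈ K, dist x y < ε) :
    TotallyBounded S := by
  refine Metric.totallyBounded_iff.2 fun ε hε => ?_
  obtain ⟨K, hK, hSK⟩ := h (ε / 2) (half_pos hε)
  obtain ⟨t, ht, hKt⟩ := Metric.totallyBounded_iff.1 hK (ε / 2) (half_pos hε)
  refine ⟨t, ht, fun x hx => ?_⟩
  obtain ⟨y, hy, hxy⟩ := hSK x hx
  obtain ⟨z, hz, hyz⟩ := mem_iUnion₂.1 (hKt hy)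
  refine mem_iUnion₂.2 ⟨z, hz, ?_⟩
  rw [Metric.mem_ball] at hyz ⊢
  linarith [dist_triangle x y z]

theorem mul_le_lintegral_lipReg {c : ℝ → E} (hc : LipschitzWith 1 c) {a : ℝ≥0∞} {n : ℕ} {ε u : ℝ}
    (hεu : ε ≤ u) (hfar : ∀ y, H y ≤ a → 2 * ε ≤ dist (c u) y) (han : a ≤ n)
    (hnε : a ≤ n * ENNReal.ofReal ε) :
    a * ENNReal.ofReal ε ≤ ∫⁻ t in Icc 0 u, lipReg H n (c t) := by
  have hlow : ∀ t ∈ Icc (u - ε) u, a ≤ lipReg H n (c t) := fun t ht => by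
    refine le_lipReg (fun y hy => ?_) han hnε
    by_contra! hya
    have hut : dist (c u) (c t) ≤ ε := by
      refine (hc.dist_le_mul u t).trans ?_
      rw [NNReal.coe_one, one_mul, Real.dist_eq, abs_of_nonneg (sub_nonneg.2 ht.2)]
      linarith [ht.1]
    have hty : dist (c t) y < ε := (ENNReal.ofReal_lt_ofReal_iff_of_nonneg dist_nonneg).1
      (by rwa [← edist_dist])
    linarith [hfar y hya.le, dist_triangle (c u) (c t) y]
  calc a * ENNReal.ofReal ε = ∫⁻ _ in Icc (u - ε) u, a := by
        rw [setLIntegral_const, Real.volume_Icc, sub_sub_cancel]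
    _ ≤ ∫⁻ t in Icc (u - ε) u, lipReg H n (c t) := setLIntegral_mono' measurableSet_Icc hlow
    _ ≤ ∫⁻ t in Icc 0 u, lipReg H n (c t) :=
        lintegral_mono_set (Icc_subset_Icc_left (sub_nonneg.2 hεu))

theorem totallyBounded_iUnion_image_Icc (hH : ∀ a : ℕ, IsCompact {y | H y ≤ a}) {x : E}
    {c : ℕ → ℝ → E} {T : ℕ → ℝ} (hc : ∀ n, LipschitzWith 1 (c n)) (hcx : ∀ n, c n 0 = x)
    {A : ℝ≥0∞} (hA : A ≠ ∞) (hcost : ∀ n, ∫⁻ t in Icc 0 (T n), lipReg H n (c n t) ≤ A) :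
    TotallyBounded (⋃ n, c n '' Icc 0 (T n)) := by
  refine totallyBounded_of_forall_exists_dist_lt fun ε hε => ?_
  have hε2 : ENNReal.ofReal (ε / 2) ≠ 0 := by simpa using hε
  obtain ⟨a, ha⟩ := ENNReal.exists_nat_mul_gt hε2 hA
  obtain ⟨m, hm⟩ := ENNReal.exists_nat_mul_gt hε2 (ENNReal.natCast_ne_top a)
  set N := max a m
  refine ⟨({y | H y ≤ a} ∪ {x}) ∪ ⋃ n ∈ Finset.range N, c n '' Icc 0 (T n), ?_, ?_⟩
  · exact (((hH a).union isCompact_singleton).union ((Finset.range N).isCompact_biUnion fun n _ =>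
      isCompact_Icc.image (hc n).continuous)).totallyBounded
  rintro q hq
  obtain ⟨n, u, hu, rfl⟩ := mem_iUnion.1 hq
  rcases lt_or_ge n N with hn | hn
  · exact ⟨c n u, Or.inr (mem_iUnion₂.2 ⟨n, Finset.mem_range.2 hn, mem_image_of_mem _ hu⟩),
      by simpa using hε⟩
  -- by `mul_le_lintegral_lipReg` a curve point this far from `{H ≤ a}` costs more than `A`
  by_contra! hfar
  have hεu : ε ≤ u := by
    refine (hfar x (Or.inl (Or.inr rfl))).trans ?_
    simpa [hcx, Real.dist_eq, abs_of_nonneg hu.1] using (hc n).dist_le_mul u 0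
  refine ha.not_ge ((mul_le_lintegral_lipReg (hc n) (ε := ε / 2) (u := u) (by linarith)
    (fun y hy => ?_) ?_ ?_).trans ((lintegral_mono_set (Icc_subset_Icc_right hu.2)).trans
      (hcost n)))
  · rw [mul_div_cancel₀ _ two_ne_zero]
    exact hfar y (Or.inl (Or.inl hy))
  · exact_mod_cast (le_max_left a m).trans hn
  · exact hm.le.trans (by gcongr; exact (le_max_right a m).trans hn)

theorem isCompact_setOf_lipschitzWith_mem {K : Set E} (hK : IsCompact K) (L : ℝ) :
    IsCompact {f : BoundedContinuousFunction (Icc 0 L) E | LipschitzWith 1 f ∧ ∀ t, f t ∈ K} := by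
  have heval (t : Icc 0 L) : Continuous fun f : BoundedContinuousFunction (Icc 0 L) E => f t :=
    continuous_eval_const t
  refine BoundedContinuousFunction.arzela_ascoli₂ K hK _ ?_ (fun f t hf => hf.2 t)
    (LipschitzWith.uniformEquicontinuous _ 1 fun f => f.2.1).equicontinuous
  simp only [LipschitzWith, ENNReal.coe_one, one_mul, ofPred_and, ofPred_forall]
  exact (isClosed_iInter fun s => isClosed_iInter fun t =>
    isClosed_le ((heval s).edist (heval t)) continuous_const).inter
      (isClosed_iInter fun t => hK.isClosed.preimage (heval t))

theorem exists_subseq_tendsto_curve {K : Set E} (hK : IsCompact K) {c : ℕ → ℝ → E} {T : ℕ → ℝ}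
    (hc : ∀ n, LipschitzWith 1 (c n)) (hcK : ∀ n, ∀ t ∈ Icc 0 (T n), c n t ∈ K)
    (hT : ∀ n, 0 ≤ T n) (hT' : BddAbove (range T)) :
    ∃ (κ : ℝ → E) (τ : ℝ) (φ : ℕ → ℕ), StrictMono φ ∧ LipschitzWith 1 κ ∧ 0 ≤ τ ∧
      Tendsto (T ∘ φ) atTop (𝓝 τ) ∧
      Tendsto (fun n => c (φ n) 0) atTop (𝓝 (κ 0)) ∧
      (∀ t ∈ Ico 0 τ, Tendsto (fun n => c (φ n) t) atTop (𝓝 (κ t))) ∧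
      Tendsto (fun n => c (φ n) (T (φ n))) atTop (𝓝 (κ τ)) := by
  obtain ⟨L, hTL⟩ := hT'
  replace hTL (n : ℕ) : T n ≤ L := hTL (mem_range_self n)
  have hL : 0 ≤ L := (hT 0).trans (hTL 0)
  let stopped (n : ℕ) (t : ℝ) : E := c n (projIcc 0 (T n) (hT n) t)
  have stopped_eq (n : ℕ) {t : ℝ} (ht : t ∈ Icc 0 (T n)) : stopped n t = c n t := by
    simp only [stopped, projIcc_of_mem (hT n) ht]
  have stopped_lip (n : ℕ) : LipschitzWith 1 (stopped n) := by
    simpa [Function.comp_def] using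
      (hc n).comp ((LipschitzWith.subtype_val _).comp (LipschitzWith.projIcc (hT n)))
  let f (n : ℕ) : BoundedContinuousFunction (Icc 0 L) E :=
    BoundedContinuousFunction.mkOfCompact
      ⟨fun t => stopped n t, (stopped_lip n).continuous.comp continuous_subtype_val⟩
  obtain ⟨⟨k, τ⟩, ⟨⟨hk, -⟩, -⟩, φ, hφ, hlim⟩ :=
    ((isCompact_setOf_lipschitzWith_mem hK L).prod isCompact_univ).tendsto_subseq
      (x := fun n => (f n, (⟨T n, hT n, hTL n⟩ : Icc 0 L)))
      fun n => ⟨⟨fun s t => stopped_lip n s t, fun t => hcK n _ (projIcc 0 (T n) (hT n) t).2⟩,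
        mem_univ _⟩
  have hfk : Tendsto (f ∘ φ) atTop (𝓝 k) := (continuous_fst.tendsto _).comp hlim
  have hTτ : Tendsto (fun n => (⟨T (φ n), hT _, hTL _⟩ : Icc 0 L)) atTop (𝓝 τ) :=
    (continuous_snd.tendsto _).comp hlim
  have hTτ' : Tendsto (T ∘ φ) atTop (𝓝 τ) := (continuous_subtype_val.tendsto _).comp hTτ
  have hpt {t : ℝ} (ht : t ∈ Icc 0 L) : Tendsto (fun n => stopped (φ n) t) atTop
      (𝓝 (k (projIcc 0 L hL t))) := by
    rw [projIcc_of_mem hL ht]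
    exact ((continuous_eval_const (⟨t, ht⟩ : Icc 0 L)).tendsto k).comp hfk
  refine ⟨fun t => k (projIcc 0 L hL t), τ, φ, hφ, ?_, τ.2.1, hTτ', ?_, fun t ht => ?_, ?_⟩
  · simpa [Function.comp_def] using hk.comp (LipschitzWith.projIcc hL)
  · exact (hpt ⟨le_rfl, hL⟩).congr fun n => stopped_eq _ ⟨le_rfl, hT _⟩
  · refine (hpt ⟨ht.1, ht.2.le.trans τ.2.2⟩).congr' ?_
    filter_upwards [hTτ'.eventually_const_lt ht.2] with n hn
    exact stopped_eq _ ⟨ht.1, hn.le⟩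
  · beta_reduce
    rw [projIcc_val]
    exact (hfk.eval hTτ).congr fun n => stopped_eq _ ⟨hT _, le_rfl⟩

theorem cost_le_liminf_cost (hF : LowerSemicontinuous F) (hH : LowerSemicontinuous H)
    {k : ℕ → ℕ} (hk : Tendsto k atTop atTop) {c : ℕ → ℝ → E} (hc : ∀ n, Continuous (c n))
    {T : ℕ → ℝ} {κ : ℝ → E} {τ : ℝ} (hT : Tendsto T atTop (𝓝 τ))
    (hcκ : ∀ t ∈ Ico 0 τ, Tendsto (fun n => c n t) atTop (𝓝 (κ t)))
    (hcT : Tendsto (fun n => c n (T n)) atTop (𝓝 (κ τ))) :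
    cost F H κ τ ≤ liminf (fun n => cost F (lipReg H (k n)) (c n) (T n)) atTop := by
  have hterminal : F (κ τ) ≤ liminf (fun n => F (c n (T n))) atTop :=
    (hF.le_liminf _).trans (liminf_le_liminf_of_le hcT)
  have hrunning : ∫⁻ t in Icc 0 τ, H (κ t) ≤
      liminf (fun n => ∫⁻ t in Icc 0 (T n), lipReg H (k n) (c n t)) atTop := by
    simp only [← setLIntegral_congr (Ico_ae_eq_Icc (a := (0 : ℝ)) (b := τ)),
      ← lintegral_indicator measurableSet_Ico, ← lintegral_indicator measurableSet_Icc]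
    refine (lintegral_mono fun t => ?_).trans (lintegral_liminf_le fun n =>
      ((continuous_lipReg _).comp (hc n)).measurable.indicator measurableSet_Icc)
    by_cases ht : t ∈ Ico 0 τ
    · rw [indicator_of_mem ht]
      refine (le_liminf_lipReg hH hk (hcκ t ht)).trans (liminf_le_liminf ?_)
      filter_upwards [hT.eventually_const_lt ht.2] with n hn
      rw [indicator_of_mem (show t ∈ Icc 0 (T n) from ⟨ht.1, hn.le⟩)]
    · rw [indicator_of_notMem ht]
      exact bot_le
  exact (add_le_add hterminal hrunning).trans (ennreal_le_liminf_add _ _ _)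

theorem bddAbove_range_of_lintegral_lipReg_le {δ : ℝ≥0} (hδ : 0 < δ) (hδH : ∀ y, δ ≤ H y)
    {c : ℕ → ℝ → E} {T : ℕ → ℝ} {A : ℝ≥0∞} (hA : A ≠ ∞)
    (hcost : ∀ n, ∫⁻ t in Icc 0 (T n), lipReg H n (c n t) ≤ A) : BddAbove (range T) := by
  obtain ⟨m, hm⟩ := exists_nat_ge δ
  refine (isBoundedUnder_of_eventually_le (a := (A / δ).toReal) ?_).bddAbove_range
  filter_upwards [eventually_ge_atTop m] with n hn
  rw [← ENNReal.ofReal_le_iff_le_toReal (ENNReal.div_ne_top hA (by simpa using hδ.ne')),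
    ENNReal.le_div_iff_mul_le (by simp [hδ.ne']) (by simp)]
  refine le_trans ?_ (hcost n)
  rw [mul_comm, ← sub_zero (T n), ← Real.volume_Icc, ← setLIntegral_const, sub_zero]
  exact lintegral_mono fun t => le_lipReg_of_forall_le hδH
    (by exact_mod_cast hm.trans (by exact_mod_cast hn)) _

theorem iSup_valueFun_lipReg [CompleteSpace E] (hF : LowerSemicontinuous F)
    (hH : LowerSemicontinuous H) (hHc : ∀ a : ℕ, IsCompact {y | H y ≤ a}) {δ : ℝ≥0} (hδ : 0 < δ)
    (hδH : ∀ y, δ ≤ H y) (x : E) :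
    ⨆ n, valueFun F (lipReg H n) x = valueFun F H x := by
  refine le_antisymm (iSup_le fun n => valueFun_mono (lipReg_le_self n) x)
    (le_of_forall_gt_imp_ge_of_dense fun b hb => ?_)
  rcases eq_or_ne b ∞ with rfl | hb_top
  · exact le_top
  choose c T hc hcx hT hcost using fun n =>
    exists_cost_lt_of_valueFun_lt ((le_iSup (fun n => valueFun F (lipReg H n) x) n).trans_lt hb)
  have hcost' (n : ℕ) : ∫⁻ t in Icc 0 (T n), lipReg H n (c n t) ≤ b :=
    le_add_self.trans (hcost n).le
  have hK := (totallyBounded_iUnion_image_Icc hHc hc hcx hb_top hcost').closure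
    |>.isCompact_of_isClosed isClosed_closure
  obtain ⟨κ, τ, φ, hφ, hκ, hτ, hTτ, hκ0, hcκ, hκτ⟩ := exists_subseq_tendsto_curve hK hc
    (fun n t ht => subset_closure (mem_iUnion.2 ⟨n, mem_image_of_mem _ ht⟩)) hT
    (bddAbove_range_of_lintegral_lipReg_le hδ hδH hb_top hcost')
  obtain rfl : x = κ 0 := tendsto_nhds_unique (by simp only [hcx, tendsto_const_nhds]) hκ0
  calc valueFun F H (κ 0) ≤ cost F H κ τ := valueFun_le_cost hκ hτ
    _ ≤ liminf (fun n => cost F (lipReg H (φ n)) (c (φ n)) (T (φ n))) atTop :=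
        cost_le_liminf_cost hF hH hφ.tendsto_atTop (fun n => (hc _).continuous) hTτ hcκ hκτ
    _ ≤ b := liminf_le_of_frequently_le' (Frequently.of_forall fun n => (hcost (φ n)).le)

end LimitCurve

section ArcLength

section Variation

variable {E : Type*} [PseudoEMetricSpace E] {c : ℝ → E} {I : Set ℝ} {K : ℝ≥0}

theorem eVariationOn_inter_Icc_le (hc : LipschitzOnWith K c I) (x y : ℝ) :
    eVariationOn c (I ∩ Icc x y) ≤ K * ENNReal.ofReal (y - x) :=
  calc eVariationOn c (I ∩ Icc x y)
      ≤ K * eVariationOn id (I ∩ Icc x y) := hc.comp_eVariationOn_le fun _ ht => ht.1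
    _ ≤ K * ENNReal.ofReal (y - x) := by
        gcongr
        exact (eVariationOn.mono _ inter_subset_right).trans (eVariationOn_id_Icc x y).le

theorem lipschitzOnWith_variationOnFromTo (hc : LipschitzOnWith K c I) {a : ℝ} (ha : a ∈ I) :
    LipschitzOnWith K (variationOnFromTo c I a) I := by
  refine .of_le_add_mul K fun x hx y hy => ?_
  rw [← variationOnFromTo.add hc.locallyBoundedVariationOn ha hy hx]
  gcongr
  rcases le_total x y with hxy | hyx
  · exact (variationOnFromTo.nonpos_of_ge _ _ hxy).trans (by positivity)
  · rw [variationOnFromTo.eq_of_le _ _ hyx, Real.dist_eq, abs_of_nonneg (sub_nonneg.2 hyx)]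
    refine ENNReal.toReal_le_of_le_ofReal (by have := sub_nonneg.2 hyx; positivity) ?_
    rw [ENNReal.ofReal_mul K.coe_nonneg, ENNReal.ofReal_coe_nnreal]
    exact eVariationOn_inter_Icc_le hc y x

theorem image_variationOnFromTo_Icc {T : ℝ} (hT : 0 ≤ T) (hc : LipschitzOnWith K c (Icc 0 T)) :
    variationOnFromTo c (Icc 0 T) 0 '' Icc 0 T = Icc 0 (variationOnFromTo c (Icc 0 T) 0 T) := by
  have h0 : (0 : ℝ) ∈ Icc 0 T := left_mem_Icc.2 hT
  have hmono := variationOnFromTo.monotoneOn hc.locallyBoundedVariationOn h0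
  have hzero := variationOnFromTo.self c (Icc 0 T) 0
  refine Subset.antisymm ?_ ?_
  · simpa only [hzero] using hmono.image_Icc_subset
  · simpa only [hzero] using
      intermediate_value_Icc hT (lipschitzOnWith_variationOnFromTo hc h0).continuousOn

end Variation

theorem restrict_image_le_map {s : ℝ → ℝ} {A : Set ℝ}
    (hs : LipschitzOnWith 1 s A) (hsm : AEMeasurable s (volume.restrict A)) :
    volume.restrict (s '' A) ≤ Measure.map s (volume.restrict A) := by
  refine Measure.le_iff.2 fun B hB => ?_
  rw [Measure.restrict_apply hB, Measure.map_apply_of_aemeasurable hsm hB,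
    ← image_preimage_inter]
  refine le_trans ?_ (Measure.le_restrict_apply _ _)
  rw [← hausdorffMeasure_real]
  simpa using (hs.mono (s := s ⁻¹' B ∩ A) inter_subset_right).hausdorffMeasure_image_le zero_le_one

theorem setLIntegral_image_le {s : ℝ → ℝ} {A : Set ℝ} (hA : MeasurableSet A)
    (hsA : MeasurableSet (s '' A)) (hs : LipschitzOnWith 1 s A) {k : ℝ → ℝ≥0∞}
    (hk : Measurable ((s '' A).indicator k)) :
    ∫⁻ u in s '' A, k u ≤ ∫⁻ t in A, k (s t) := by
  have hsm : AEMeasurable s (volume.restrict A) := hs.continuousOn.aemeasurable hA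
  calc ∫⁻ u in s '' A, k u = ∫⁻ u in s '' A, (s '' A).indicator k u :=
        setLIntegral_congr_fun hsA fun u hu => (indicator_of_mem hu k).symm
    _ ≤ ∫⁻ u, (s '' A).indicator k u ∂(Measure.map s (volume.restrict A)) :=
        lintegral_mono' (restrict_image_le_map hs hsm) le_rfl
    _ = ∫⁻ t in A, (s '' A).indicator k (s t) := lintegral_map' hk.aemeasurable hsm
    _ = ∫⁻ t in A, k (s t) :=
        setLIntegral_congr_fun hA fun t ht => indicator_of_mem (mem_image_of_mem s ht) k

variable {X : Type*} [MetricSpace X]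

theorem exists_rectCurve_lineIntegral_le [MeasurableSpace X] [BorelSpace X] {c : ℝ → X} {T : ℝ}
    (hT : 0 ≤ T) (hc : LipschitzOnWith 1 c (Icc 0 T)) (hne : c 0 ≠ c T)
    {h : X → ℝ≥0∞} (hh : Measurable h) :
    ∃ γ : RectCurve X, γ.toFun γ.a = c 0 ∧ γ.toFun γ.b = c T ∧
      γ.lineIntegral h ≤ ∫⁻ t in Icc 0 T, h (c t) := by
  have h0 : (0 : ℝ) ∈ Icc 0 T := left_mem_Icc.2 hT
  have hbv := hc.locallyBoundedVariationOn
  set s := variationOnFromTo c (Icc 0 T) 0 with hs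
  set N := naturalParameterization c (Icc 0 T) 0
  have hNs : ∀ t ∈ Icc 0 T, N (s t) = c t := fun t ht =>
    edist_eq_zero.1 (edist_naturalParameterization_eq_zero hbv h0 ht)
  have hs0 : s 0 = 0 := variationOnFromTo.self _ _ _
  have hN0 : N 0 = c 0 := by rw [← hNs 0 h0, hs0]
  have hNT : N (s T) = c T := hNs T (right_mem_Icc.2 hT)
  have hlength : 0 < s T := by
    refine (variationOnFromTo.nonneg_of_le _ _ hT).lt_of_ne fun hsT => hne ?_
    rw [← hN0, ← hNT, hs, ← hsT]
  have himage : s '' Icc 0 T = Icc 0 (s T) := image_variationOnFromTo_Icc hT hc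
  have hspeed := has_unit_speed_naturalParameterization c hbv h0
  rw [← hs, himage] at hspeed
  let γ : RectCurve X := ⟨0, s T, hlength, N, hspeed⟩
  refine ⟨γ, hN0, hNT, ?_⟩
  have hmeas : Measurable ((s '' Icc 0 T).indicator fun u => h (N u)) := by
    rw [himage]
    have hpiecewise : Measurable fun u => h ((Icc 0 (s T)).piecewise N (fun _ => c 0) u) :=
      hh.comp (γ.continuousOn.measurable_piecewise continuousOn_const measurableSet_Icc)
    convert hpiecewise.indicator measurableSet_Icc using 1
    exact indicator_congr fun u hu => by rw [piecewise_eq_of_mem _ _ _ hu]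
  calc γ.lineIntegral h = ∫⁻ u in s '' Icc 0 T, h (N u) := by rw [himage]; rfl
    _ ≤ ∫⁻ t in Icc 0 T, h (N (s t)) := setLIntegral_image_le measurableSet_Icc
        (himage ▸ measurableSet_Icc) (lipschitzOnWith_variationOnFromTo hc h0) hmeas
    _ = ∫⁻ t in Icc 0 T, h (c t) :=
        setLIntegral_congr_fun measurableSet_Icc fun t ht => by simp only [hNs t ht]

/-- `H` dominates the increments of `f` along every rectifiable curve, without exceptional curves
and without any measurability. -/
def IsUpperGradient (f : X → ℝ) (H : X → ℝ≥0∞) : Prop :=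
  ∀ γ : RectCurve X, edist (f (γ.toFun γ.a)) (f (γ.toFun γ.b)) ≤ γ.lineIntegral H

theorem IsUpperGradient.edist_le_setLIntegral [MeasurableSpace X] [BorelSpace X] {f : X → ℝ}
    {H : X → ℝ≥0∞} (hf : IsUpperGradient f H) (hH : Measurable H) {c : ℝ → X} {T : ℝ} (hT : 0 ≤ T)
    (hc : LipschitzOnWith 1 c (Icc 0 T)) :
    edist (f (c 0)) (f (c T)) ≤ ∫⁻ t in Icc 0 T, H (c t) := by
  rcases eq_or_ne (c 0) (c T) with heq | hne
  · simp [heq]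
  · obtain ⟨γ, ha, hb, hγ⟩ := exists_rectCurve_lineIntegral_le hT hc hne hH
    rw [← ha, ← hb]
    exact (hf γ).trans hγ

end ArcLength

section SignedPow

/-- The odd power `s ↦ sign(s) |s|^p`, used as a test function in the `(1,1)`-Poincaré
inequality. -/
noncomputable def signedPow (p s : ℝ) : ℝ := s * |s| ^ (p - 1)

variable {p : ℝ}

theorem signedPow_zero (p : ℝ) : signedPow p 0 = 0 := zero_mul _

theorem abs_signedPow (hp : 0 < p) (s : ℝ) : |signedPow p s| = |s| ^ p := by
  rcases eq_or_ne s 0 with rfl | hs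
  · simp [signedPow, Real.zero_rpow hp.ne']
  · rw [signedPow, abs_mul, abs_of_nonneg (Real.rpow_nonneg (abs_nonneg s) _),
      Real.rpow_sub_one (abs_ne_zero.2 hs), mul_div_cancel₀ _ (abs_ne_zero.2 hs)]

theorem enorm_signedPow (hp : 0 < p) (s : ℝ) : ‖signedPow p s‖ₑ = ‖s‖ₑ ^ p := by
  rw [Real.enorm_eq_ofReal_abs, Real.enorm_eq_ofReal_abs, abs_signedPow hp,
    ENNReal.ofReal_rpow_of_nonneg (abs_nonneg s) hp.le]

theorem continuous_signedPow (hp : 1 ≤ p) : Continuous (signedPow p) :=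
  continuous_id.mul (continuous_abs.rpow_const fun _ => Or.inr (sub_nonneg.2 hp))

theorem hasDerivAt_signedPow (hp : 1 < p) (s : ℝ) :
    HasDerivAt (signedPow p) (p * |s| ^ (p - 1)) s := by
  rcases eq_or_ne s 0 with rfl | hs
  · rw [hasDerivAt_iff_tendsto_slope]
    have hcont : Continuous fun t : ℝ => |t| ^ (p - 1) :=
      continuous_abs.rpow_const fun _ => Or.inr (by linarith)
    have hlim := (hcont.tendsto 0).mono_left (nhdsWithin_le_nhds (s := {0}ᶜ))
    rw [abs_zero, Real.zero_rpow (by linarith : p - 1 ≠ 0)] at hlim ⊢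
    rw [mul_zero]
    refine hlim.congr' ?_
    filter_upwards [self_mem_nhdsWithin] with t ht
    rw [slope_def_field, signedPow_zero, signedPow, sub_zero, sub_zero, mul_div_cancel_left₀ _ ht]
  · have h := (hasDerivAt_id s).mul ((hasDerivAt_abs hs).rpow_const (p := p - 1)
      (Or.inl (abs_ne_zero.2 hs)))
    refine h.congr_deriv ?_
    rw [Real.rpow_sub_one (abs_ne_zero.2 hs) (p - 1), id, ← mul_assoc, ← mul_assoc, self_mul_sign,
      mul_assoc, mul_div_assoc']
    field_simp [abs_ne_zero.2 hs]
    ring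

theorem monotone_signedPow (hp : 1 < p) : Monotone (signedPow p) :=
  monotone_of_hasDerivAt_nonneg (hasDerivAt_signedPow hp) fun s => by positivity

theorem locallyLipschitz_signedPow (hp : 1 < p) : LocallyLipschitz (signedPow p) := by
  refine ContDiff.locallyLipschitz (𝕂 := ℝ) (contDiff_one_iff_deriv.2
    ⟨fun s => (hasDerivAt_signedPow hp s).differentiableAt, ?_⟩)
  rw [funext fun s => (hasDerivAt_signedPow hp s).deriv]
  exact continuous_const.mul (continuous_abs.rpow_const fun _ => Or.inr (by linarith))

end SignedPow

section Slope

variable {X : Type*} [MetricSpace X] {v : X → ℝ} {x : X}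

theorem slope_ne_top (hv : LocallyLipschitz v) (x : X) : slope v x ≠ ∞ := by
  obtain ⟨K, t, ht, hK⟩ := hv x
  refine ne_top_of_le_ne_top (ENNReal.coe_ne_top (r := K)) ?_
  refine limsup_le_of_le (by isBoundedDefault) ?_
  filter_upwards [mem_nhdsWithin_of_mem_nhds ht] with y hy
  exact ENNReal.div_le_of_le_mul (hK (mem_of_mem_nhds ht) hy)

theorem slope_comp_le {φ : ℝ → ℝ} {φ' : ℝ} (hφ : HasDerivAt φ φ' (v x)) (hv : ContinuousAt v x)
    (hx : slope v x ≠ ∞) : slope (φ ∘ v) x ≤ ‖φ'‖ₑ * slope v x := by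
  rcases (𝓝[≠] x).eq_or_neBot with hbot | hne
  · simp [slope, hbot]
  have hquot : ∀ y, edist (φ (v x)) (φ (v y)) / edist x y =
      ‖dslope φ (v x) (v y)‖ₑ * (edist (v x) (v y) / edist x y) := fun y => by
    rw [← mul_div_assoc, edist_comm, edist_comm (v x), edist_eq_enorm_sub, edist_eq_enorm_sub,
      ← enorm_mul, mul_comm, ← smul_eq_mul (v y - v x), sub_smul_dslope]
  have hlim : Tendsto (fun y => ‖dslope φ (v x) (v y)‖ₑ) (𝓝[≠] x) (𝓝 ‖φ'‖ₑ) := by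
    have hd : ContinuousAt (dslope φ (v x)) (v x) :=
      continuousAt_dslope_same.2 hφ.differentiableAt
    have := ((hd.comp hv).enorm.tendsto).mono_left (nhdsWithin_le_nhds (s := {x}ᶜ))
    simpa [hφ.deriv] using this
  simp only [slope, Function.comp_apply, hquot]
  refine (ENNReal.limsup_mul_le' (Or.inr hx) (Or.inl ?_)).trans_eq ?_
  · rw [hlim.limsup_eq]; exact enorm_ne_top
  · rw [hlim.limsup_eq]

theorem slope_signedPow_sub_le {p : ℝ} (hp : 1 < p) (hv : LocallyLipschitz v) (c : ℝ) (x : X) :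
    slope (fun y => signedPow p (v y - c)) x ≤
      ENNReal.ofReal p * (edist (v x) c ^ (p - 1) * slope v x) := by
  have hφ : HasDerivAt (fun s => signedPow p (s - c)) (p * |v x - c| ^ (p - 1)) (v x) :=
    (hasDerivAt_signedPow hp _).comp_sub_const _ _
  refine (slope_comp_le hφ hv.continuous.continuousAt (slope_ne_top hv x)).trans_eq ?_
  rw [enorm_mul, Real.enorm_rpow_of_nonneg (abs_nonneg _) (by linarith), Real.enorm_abs,
    Real.enorm_of_nonneg (by linarith), edist_eq_enorm_sub, mul_assoc]

end Slope

section Oscillation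

variable {α : Type*} [MeasurableSpace α] {μ : Measure α} {p : ℝ} {f : α → ℝ}

/-- The `p`-th power of the `L^p` mean oscillation, written as a double integral so that it is
defined without integrability and is lower semicontinuous under pointwise convergence. -/
noncomputable def oscillation (p : ℝ) (μ : Measure α) (f : α → ℝ) : ℝ≥0∞ :=
  ∫⁻ x, ∫⁻ y, edist (f x) (f y) ^ p ∂μ ∂μ

theorem oscillation_congr_ae {g : α → ℝ} (h : f =ᵐ[μ] g) :
    oscillation p μ f = oscillation p μ g := by
  refine lintegral_congr_ae ?_
  filter_upwards [h] with x hx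
  refine lintegral_congr_ae ?_
  filter_upwards [h] with y hy
  rw [hx, hy]

theorem oscillation_le_lintegral_edist (hp : 1 ≤ p) (hf : Measurable f) (c : ℝ) :
    oscillation p μ f ≤ 2 ^ p * μ univ * ∫⁻ x, edist (f x) c ^ p ∂μ := by
  have hm : Measurable fun x => edist (f x) c ^ p := (hf.edist measurable_const).pow_const p
  set a := ∫⁻ x, edist (f x) c ^ p ∂μ
  calc oscillation p μ f
      ≤ ∫⁻ x, ∫⁻ y, 2 ^ (p - 1) * (edist (f x) c ^ p + edist (f y) c ^ p) ∂μ ∂μ := by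
        refine lintegral_mono fun x => lintegral_mono fun y => ?_
        refine le_trans ?_ (ENNReal.rpow_add_le_mul_rpow_add_rpow _ _ hp)
        exact ENNReal.rpow_le_rpow (edist_triangle_right _ _ _) (by linarith)
    _ = ∫⁻ x, 2 ^ (p - 1) * (edist (f x) c ^ p * μ univ + a) ∂μ := by
        refine lintegral_congr fun x => ?_
        rw [lintegral_const_mul _ (hm.const_add _), lintegral_add_left measurable_const,
          lintegral_const]
    _ = 2 ^ (p - 1) * (a * μ univ + a * μ univ) := by
        rw [lintegral_const_mul _ ((hm.mul_const _).add_const _),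
          lintegral_add_left (hm.mul_const _), lintegral_mul_const _ hm, lintegral_const]
    _ = 2 ^ (p - 1) * 2 ^ (1 : ℝ) * μ univ * a := by rw [ENNReal.rpow_one]; ring
    _ = 2 ^ p * μ univ * a := by
        rw [← ENNReal.rpow_add _ _ two_ne_zero ENNReal.ofNat_ne_top, sub_add_cancel]

theorem lintegral_le_lintegral_rpow [IsProbabilityMeasure μ] (hp : 1 ≤ p) {g : α → ℝ≥0∞}
    (hg : AEMeasurable g μ) : (∫⁻ x, g x ∂μ) ^ p ≤ ∫⁻ x, g x ^ p ∂μ := by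
  have h := eLpNorm'_le_eLpNorm'_of_exponent_le one_pos hp μ hg.aestronglyMeasurable
  simp only [eLpNorm', enorm_eq_self, ENNReal.rpow_one, one_div, inv_one] at h
  exact (ENNReal.le_rpow_inv_iff (one_pos.trans_le hp)).1 h

theorem edist_integral_le [IsProbabilityMeasure μ] (hf : Integrable f μ) (s : ℝ) :
    edist s (∫ y, f y ∂μ) ≤ ∫⁻ y, edist s (f y) ∂μ := by
  have hsub : s - ∫ y, f y ∂μ = ∫ y, (s - f y) ∂μ := by
    rw [integral_sub (integrable_const _) hf, integral_const, probReal_univ, one_smul]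
  simpa only [edist_eq_enorm_sub, hsub] using enorm_integral_le_lintegral_enorm _

theorem lintegral_edist_average_le_oscillation [IsFiniteMeasure μ] (hp : 1 ≤ p)
    (hf : Integrable f μ) :
    ∫⁻ x, edist (f x) (⨍ y, f y ∂μ) ^ p ∂μ ≤ (μ univ)⁻¹ * oscillation p μ f := by
  rcases eq_or_ne μ 0 with rfl | hμ
  · simp
  have : NeZero μ := ⟨hμ⟩
  have hinv : (μ univ)⁻¹ ≠ ∞ := ENNReal.inv_ne_top.2 (by simpa using hμ)
  rw [oscillation, ← lintegral_const_mul' _ _ hinv]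
  refine lintegral_mono fun x => ?_
  have hfν : Integrable f ((μ univ)⁻¹ • μ) := hf.smul_measure hinv
  calc edist (f x) (⨍ y, f y ∂μ) ^ p
      ≤ (∫⁻ y, edist (f x) (f y) ∂((μ univ)⁻¹ • μ)) ^ p :=
        ENNReal.rpow_le_rpow (edist_integral_le hfν _) (by linarith)
    _ ≤ ∫⁻ y, edist (f x) (f y) ^ p ∂((μ univ)⁻¹ • μ) :=
        lintegral_le_lintegral_rpow hp (aemeasurable_const.edist hfν.aemeasurable)
    _ = (μ univ)⁻¹ * ∫⁻ y, edist (f x) (f y) ^ p ∂μ := lintegral_smul_measure ..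

theorem oscillation_le_liminf [SFinite μ] {F : ℕ → α → ℝ} (hF : ∀ n, AEMeasurable (F n) μ)
    (hlim : ∀ᵐ x ∂μ, Tendsto (fun n => F n x) atTop (𝓝 (f x))) :
    oscillation p μ f ≤ liminf (fun n => oscillation p μ (F n)) atTop := by
  have hm : ∀ n, AEMeasurable (Function.uncurry fun x y => edist (F n x) (F n y) ^ p)
      (μ.prod μ) := fun n =>
    ((hF n).comp_fst.edist (hF n).comp_snd).pow_const p
  calc oscillation p μ f
      ≤ ∫⁻ x, liminf (fun n => ∫⁻ y, edist (F n x) (F n y) ^ p ∂μ) atTop ∂μ := by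
        refine lintegral_mono_ae ?_
        filter_upwards [hlim] with x hx
        refine le_trans (lintegral_mono_ae ?_) (lintegral_liminf_le' fun n =>
          (aemeasurable_const.edist (hF n)).pow_const p)
        filter_upwards [hlim] with y hy
        exact (((ENNReal.continuous_rpow_const (y := p)).tendsto _).comp
          (hx.edist hy)).liminf_eq.ge
    _ ≤ liminf (fun n => oscillation p μ (F n)) atTop :=
        lintegral_liminf_le' fun n => (hm n).lintegral_prod_right'

end Oscillation

section MeanZeroShift

variable {α : Type*} {φ : ℝ → ℝ} {v : α → ℝ} {a b : ℝ}

theorem abs_comp_sub_le (hφm : Monotone φ) (hv : ∀ x, v x ∈ Icc a b) {c : ℝ} (hc : c ∈ Icc a b)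
    (x : α) : |φ (v x - c)| ≤ max |φ (a - b)| |φ (b - a)| :=
  abs_le_max_abs_abs (hφm (sub_le_sub (hv x).1 hc.2)) (hφm (sub_le_sub (hv x).2 hc.1))

theorem exists_integral_comp_sub_eq_zero [MeasurableSpace α] {μ : Measure α} [IsFiniteMeasure μ]
    (hφ : Continuous φ) (hφm : Monotone φ) (hφ0 : φ 0 = 0) (hab : a ≤ b) (hvm : Measurable v)
    (hv : ∀ x, v x ∈ Icc a b) :
    ∃ c ∈ Icc a b, ∫ x, φ (v x - c) ∂μ = 0 := by
  have hcont : ContinuousOn (fun c => ∫ x, φ (v x - c) ∂μ) (Icc a b) :=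
    continuousOn_of_dominated (bound := fun _ => max |φ (a - b)| |φ (b - a)|)
      (fun c _ => (hφ.measurable.comp (hvm.sub_const c)).aestronglyMeasurable)
      (fun c hc => .of_forall (abs_comp_sub_le hφm hv hc)) (integrable_const _)
      (.of_forall fun x => (hφ.comp (continuous_const.sub continuous_id)).continuousOn)
  have hleft : 0 ≤ ∫ x, φ (v x - a) ∂μ :=
    integral_nonneg fun x => hφ0.symm.trans_le (hφm (sub_nonneg.2 (hv x).1))
  have hright : ∫ x, φ (v x - b) ∂μ ≤ 0 :=
    integral_nonpos fun x => (hφm (sub_nonpos.2 (hv x).2)).trans_eq hφ0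
  exact intermediate_value_Icc' hab hcont ⟨hright, hleft⟩

end MeanZeroShift

section HolderAbsorption

theorem le_rpow_mul_of_le_mul_rpow_mul_rpow {p q : ℝ} (hpq : p.HolderConjugate q)
    {a b K : ℝ≥0∞} (ha : a ≠ ∞) (h : a ≤ K * (a ^ (1 / q) * b ^ (1 / p))) : a ≤ K ^ p * b := by
  rcases eq_or_ne a 0 with rfl | ha0
  · exact bot_le
  have hsplit : a = a ^ (1 / q) * a ^ (1 / p) := by
    rw [← ENNReal.rpow_add _ _ ha0 ha, one_div, one_div, hpq.symm.inv_add_inv_eq_one,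
      ENNReal.rpow_one]
  have hcancel : a ^ (1 / p) ≤ K * b ^ (1 / p) := by
    rw [← ENNReal.mul_le_mul_iff_right (ENNReal.rpow_pos (pos_iff_ne_zero.2 ha0) ha).ne'
      (ENNReal.rpow_ne_top_of_nonneg hpq.symm.one_div_nonneg ha), ← hsplit]
    exact h.trans_eq (mul_left_comm ..)
  have hpow := ENNReal.rpow_le_rpow hcancel hpq.nonneg
  rwa [ENNReal.mul_rpow_of_nonneg _ _ hpq.nonneg, ← ENNReal.rpow_mul, ← ENNReal.rpow_mul,
    one_div_mul_cancel hpq.ne_zero, ENNReal.rpow_one, ENNReal.rpow_one] at hpow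

theorem lintegral_rpow_le_of_le_mul_lintegral {α : Type*} [MeasurableSpace α] {μ : Measure α}
    {p : ℝ} (hp : 1 < p) {g h : α → ℝ≥0∞} (hg : AEMeasurable g μ) (hh : AEMeasurable h μ)
    {K : ℝ≥0∞} (hfin : ∫⁻ x, g x ^ p ∂μ ≠ ∞)
    (hle : ∫⁻ x, g x ^ p ∂μ ≤ K * ∫⁻ x, g x ^ (p - 1) * h x ∂μ) :
    ∫⁻ x, g x ^ p ∂μ ≤ K ^ p * ∫⁻ x, h x ^ p ∂μ := by
  have hpq : p.HolderConjugate (p / (p - 1)) := .conjExponent hp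
  have hholder := ENNReal.lintegral_mul_le_Lp_mul_Lq μ hpq.symm (hg.pow_const (p - 1)) hh
  have hexp : (p - 1) * (p / (p - 1)) = p := mul_div_cancel₀ p (sub_ne_zero.2 hp.ne')
  simp only [Pi.mul_apply, ← ENNReal.rpow_mul, hexp] at hholder
  exact le_rpow_mul_of_le_mul_rpow_mul_rpow hpq hfin (hle.trans (by gcongr))

end HolderAbsorption

section GlobalPoincare

variable {X : Type*} [MetricSpace X] [MeasurableSpace X] {μ : Measure X} [IsFiniteMeasure μ]
  {A : ℝ≥0} {p : ℝ}

/-- The global `(1,1)`-Poincaré inequality with constant `A`; unlike the local inequality it is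
not normalized by the measure of balls. -/
def GlobalPoincare (A : ℝ≥0) (μ : Measure X) : Prop :=
  ∀ w : X → ℝ, LocallyLipschitz w → Integrable w μ →
    ∫⁻ y, edist (w y) (⨍ z, w z ∂μ) ∂μ ≤ A * ∫⁻ y, slope w y ∂μ

theorem WeakLocalPoincare.exists_globalPoincare {D : ℝ} (hD : ∀ x y : X, dist x y ≤ D)
    (hP : WeakLocalPoincare μ) : ∃ A : ℝ≥0, GlobalPoincare A μ := by
  rcases eq_or_ne μ 0 with rfl | hμ
  · exact ⟨0, fun w _ _ => by simp⟩
  obtain ⟨lam, hlam, CP, -, h⟩ := hP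
  have hμ0 : μ univ ≠ 0 := by simpa using hμ
  have hμt : μ univ ≠ ∞ := measure_ne_top μ univ
  obtain ⟨x, -⟩ := nonempty_of_measure_ne_zero hμ0
  have hD0 : 0 ≤ D := dist_nonneg.trans (hD x x)
  have hball : ∀ s, D + 1 ≤ s → Metric.ball x s = univ := fun s hs => eq_univ_of_forall fun y =>
    Metric.mem_ball.2 (by linarith [hD y x])
  refine ⟨CP (D + 2) * (D + 1).toNNReal, fun w hw hwi => ?_⟩
  have key := h w hw (D + 2) (D + 1) x (by linarith) (by linarith) hwi.integrableOn
  rw [hball _ le_rfl, hball _ (le_mul_of_one_le_left (by linarith) hlam), Measure.restrict_univ,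
    laverage_eq, laverage_eq, ← mul_div_assoc] at key
  rw [ENNReal.div_le_iff hμ0 hμt, ENNReal.div_mul_cancel hμ0 hμt] at key
  exact_mod_cast key

theorem GlobalPoincare.exists_lintegral_edist_rpow_le [BorelSpace X] (hA : GlobalPoincare A μ)
    (hp : 1 < p) {v : X → ℝ} (hv : LocallyLipschitz v) {a b : ℝ} (hab : a ≤ b)
    (hvI : ∀ x, v x ∈ Icc a b) {G : X → ℝ≥0∞} (hG : Measurable G) (hvG : ∀ x, slope v x ≤ G x) :
    ∃ c, ∫⁻ x, edist (v x) c ^ p ∂μ ≤ (A * ENNReal.ofReal p) ^ p * ∫⁻ x, G x ^ p ∂μ := by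
  have hp0 : 0 < p := by linarith
  have hvm : Measurable v := hv.continuous.measurable
  obtain ⟨c, hc, hmean⟩ := exists_integral_comp_sub_eq_zero (μ := μ) (continuous_signedPow hp.le)
    (monotone_signedPow hp) (signedPow_zero p) hab hvm hvI
  refine ⟨c, ?_⟩
  set w : X → ℝ := fun x => signedPow p (v x - c)
  have hwL : LocallyLipschitz w :=
    (locallyLipschitz_signedPow hp).comp (hv.sub (LocallyLipschitz.const c))
  have hwi : Integrable w μ := .of_bound hwL.continuous.measurable.aestronglyMeasurable _
    (.of_forall (abs_comp_sub_le (monotone_signedPow hp) hvI hc))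
  have hwedist : ∀ x, edist (w x) 0 = edist (v x) c ^ p := fun x => by
    rw [edist_zero_right, enorm_signedPow hp0, edist_eq_enorm_sub]
  have hpoincare := hA w hwL hwi
  rw [average_eq, hmean, smul_zero, lintegral_congr hwedist] at hpoincare
  refine lintegral_rpow_le_of_le_mul_lintegral hp (hvm.edist measurable_const).aemeasurable
    hG.aemeasurable ?_ ?_
  · simpa only [← hwedist, edist_zero_right] using hwi.2.ne
  · rw [mul_assoc, ← lintegral_const_mul' _ _ ENNReal.ofReal_ne_top]
    refine hpoincare.trans (mul_le_mul_right (lintegral_mono fun x => ?_) _)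
    exact (slope_signedPow_sub_le hp hv c x).trans (by gcongr; exact hvG x)

theorem GlobalPoincare.oscillation_le [BorelSpace X] (hA : GlobalPoincare A μ)
    (hp : 1 < p) {v : X → ℝ} (hv : LocallyLipschitz v) {a b : ℝ} (hab : a ≤ b)
    (hvI : ∀ x, v x ∈ Icc a b) {G : X → ℝ≥0∞} (hG : Measurable G) (hvG : ∀ x, slope v x ≤ G x) :
    oscillation p μ v ≤ 2 ^ p * μ univ * (A * ENNReal.ofReal p) ^ p * ∫⁻ x, G x ^ p ∂μ := by
  obtain ⟨c, hc⟩ := hA.exists_lintegral_edist_rpow_le hp hv hab hvI hG hvG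
  refine (oscillation_le_lintegral_edist hp.le hv.continuous.measurable c).trans ?_
  rw [mul_assoc (2 ^ p * μ univ)]
  gcongr

end GlobalPoincare

section ExtendTop

variable {X E : Type*} {ι : X → E} {F H : X → ℝ≥0∞}

/-- The extension of a function on `X` to an ambient space in which leaving `X` costs `∞`. -/
noncomputable def extendTop (ι : X → E) (F : X → ℝ≥0∞) : E → ℝ≥0∞ :=
  Function.extend ι F fun _ => ∞

theorem extendTop_apply (hι : ι.Injective) (x : X) : extendTop ι F (ι x) = F x :=
  hι.extend_apply _ _ x

theorem extendTop_of_notMem_range {y : E} (hy : y ∉ range ι) : extendTop ι F y = ∞ :=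
  Function.extend_apply' _ _ _ hy

theorem mem_range_of_extendTop_ne_top {y : E} (hy : extendTop ι F y ≠ ∞) : y ∈ range ι :=
  not_not.1 fun h => hy (extendTop_of_notMem_range h)

theorem setOf_extendTop_le (hι : ι.Injective) {a : ℝ≥0∞} (ha : a ≠ ∞) :
    {y | extendTop ι F y ≤ a} = ι '' {x | F x ≤ a} := by
  refine Subset.antisymm (fun y hy => ?_) (image_subset_iff.2 fun x hx => ?_)
  · obtain ⟨x, rfl⟩ := mem_range_of_extendTop_ne_top (ne_top_of_le_ne_top ha hy)
    exact mem_image_of_mem ι ((extendTop_apply hι x).symm.trans_le hy)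
  · exact (extendTop_apply hι x).trans_le hx

/-- The running costs for which optimal curves exist: lower semicontinuous functions with compact
sublevel sets and a positive lower bound. -/
structure IsCoercive [TopologicalSpace E] (H : E → ℝ≥0∞) : Prop where
  lowerSemicontinuous : LowerSemicontinuous H
  isCompact_setOf_le (a : ℕ) : IsCompact {y | H y ≤ a}
  exists_pos_le : ∃ δ : ℝ≥0, 0 < δ ∧ ∀ y, δ ≤ H y

variable [TopologicalSpace X] [TopologicalSpace E]

theorem lowerSemicontinuous_extendTop (hι : IsClosedEmbedding ι) (hF : LowerSemicontinuous F) :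
    LowerSemicontinuous (extendTop ι F) := by
  refine lowerSemicontinuous_iff_isClosed_preimage.2 fun a => ?_
  rcases eq_or_ne a ∞ with rfl | ha
  · simp
  · have himage := hι.isClosedMap _ (hF.isClosed_preimage a)
    exact (congrArg IsClosed (setOf_extendTop_le hι.injective ha)).mpr himage

theorem IsCoercive.extendTop (hι : IsClosedEmbedding ι) (hH : IsCoercive H) :
    IsCoercive (extendTop ι H) where
  lowerSemicontinuous := lowerSemicontinuous_extendTop hι hH.lowerSemicontinuous
  isCompact_setOf_le a := by
    rw [setOf_extendTop_le hι.injective (ENNReal.natCast_ne_top a)]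
    exact (hH.isCompact_setOf_le a).image hι.continuous
  exists_pos_le := by
    obtain ⟨δ, hδ, hδH⟩ := hH.exists_pos_le
    refine ⟨δ, hδ, fun y => ?_⟩
    by_cases hy : y ∈ range ι
    · obtain ⟨x, rfl⟩ := hy
      exact (hδH x).trans_eq (extendTop_apply hι.injective x).symm
    · exact le_top.trans_eq (extendTop_of_notMem_range hy).symm

end ExtendTop

section ValueFunctionBounds

variable {X E : Type*} [MetricSpace E] {ι : X → E} {f : X → ℝ} {F H : X → ℝ≥0∞}

theorem valueFun_extendTop_le (hι : ι.Injective) {b : ℝ} (hF : ∀ x, F x ≤ ENNReal.ofReal b)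
    (G : E → ℝ≥0∞) (x : X) : valueFun (extendTop ι F) G (ι x) ≤ ENNReal.ofReal b :=
  (valueFun_le_self _).trans ((extendTop_apply hι x).trans_le (hF x))

theorem mem_range_of_setLIntegral_extendTop_ne_top (hι : IsClosed (range ι)) {c : ℝ → E}
    (hc : Continuous c) (hc0 : c 0 ∈ range ι) (hH : Measurable fun t => extendTop ι H (c t))
    {T : ℝ} (hfin : ∫⁻ t in Icc 0 T, extendTop ι H (c t) ≠ ∞) :
    ∀ t ∈ Icc 0 T, c t ∈ range ι := by
  intro t ht
  rcases (ht.1.trans ht.2).eq_or_lt with rfl | hT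
  · rwa [le_antisymm ht.2 ht.1]
  have hae : (fun t => Metric.infDist (c t) (range ι)) =ᵐ[volume.restrict (Icc 0 T)] 0 := by
    filter_upwards [ae_lt_top hH hfin] with s hs
    exact Metric.infDist_zero_of_mem (mem_range_of_extendTop_ne_top hs.ne)
  have hzero := Measure.eqOn_Icc_of_ae_eq volume hT.ne hae
    ((Metric.continuous_infDist_pt _).comp hc).continuousOn continuousOn_const
  exact (hι.mem_iff_infDist_zero ⟨_, hc0⟩).2 (hzero ht)

variable [MetricSpace X] [MeasurableSpace X] [BorelSpace X]

theorem IsUpperGradient.ofReal_le_cost_extendTop (hf : IsUpperGradient f H) (hH : Measurable H)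
    (hfF : ∀ x, ENNReal.ofReal (f x) ≤ F x) (hι : Isometry ι) {c : ℝ → E} (hc : LipschitzWith 1 c)
    {T : ℝ} (hT : 0 ≤ T) {x : X} (hx : c 0 = ι x) (hcι : ∀ t ∈ Icc 0 T, c t ∈ range ι) :
    ENNReal.ofReal (f x) ≤ cost (extendTop ι F) (extendTop ι H) c T := by
  have : Nonempty X := ⟨x⟩
  choose! k hk using hcι
  have hkL : LipschitzOnWith 1 k (Icc 0 T) := fun s hs t ht => by
    rw [← hι.edist_eq, hk s hs, hk t ht]
    exact hc s t
  have hk0 : k 0 = x := hι.injective ((hk 0 ⟨le_rfl, hT⟩).trans hx)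
  have hint : ∫⁻ t in Icc 0 T, extendTop ι H (c t) = ∫⁻ t in Icc 0 T, H (k t) :=
    setLIntegral_congr_fun measurableSet_Icc fun t ht => by
      simp only [← hk t ht, extendTop_apply hι.injective]
  rw [cost, hint, ← hk T ⟨hT, le_rfl⟩, extendTop_apply hι.injective, ← hk0]
  calc ENNReal.ofReal (f (k 0))
      ≤ ENNReal.ofReal (f (k T) + dist (f (k 0)) (f (k T))) := by
        refine ENNReal.ofReal_le_ofReal ?_
        linarith [le_abs_self (f (k 0) - f (k T)), Real.dist_eq (f (k 0)) (f (k T))]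
    _ ≤ ENNReal.ofReal (f (k T)) + edist (f (k 0)) (f (k T)) :=
        (edist_dist (f (k 0)) (f (k T))).symm ▸ ENNReal.ofReal_add_le
    _ ≤ F (k T) + ∫⁻ t in Icc 0 T, H (k t) :=
        add_le_add (hfF _) (hf.edist_le_setLIntegral hH hT hkL)

theorem IsUpperGradient.ofReal_le_valueFun_extendTop [CompleteSpace X] (hf : IsUpperGradient f H)
    (hH : LowerSemicontinuous H) (hfF : ∀ x, ENNReal.ofReal (f x) ≤ F x) (hι : Isometry ι)
    (x : X) : ENNReal.ofReal (f x) ≤ valueFun (extendTop ι F) (extendTop ι H) (ι x) := by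
  refine le_iInf₂ fun c T => le_iInf fun ⟨hc, hx, hT⟩ => ?_
  rcases eq_or_ne (∫⁻ t in Icc 0 T, extendTop ι H (c t)) ∞ with htop | hfin
  · simp [cost, htop]
  refine hf.ofReal_le_cost_extendTop hH.measurable hfF hι hc hT hx ?_
  exact mem_range_of_setLIntegral_extendTop_ne_top hι.isClosedEmbedding.isClosed_range
    hc.continuous (hx ▸ mem_range_self x)
    ((lowerSemicontinuous_extendTop hι.isClosedEmbedding hH).comp hc.continuous).measurable hfin

end ValueFunctionBounds

section LipschitzApproximation

variable {X E : Type*} [MetricSpace X] [NormedAddCommGroup E] {ι : X → E} {F H : X → ℝ≥0∞}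
  {b p : ℝ}

theorem tendsto_toReal_valueFun_lipReg [CompleteSpace X] [CompleteSpace E] (hι : Isometry ι)
    (hF : LowerSemicontinuous F) (hFb : ∀ x, F x ≤ ENNReal.ofReal b) (hH : IsCoercive H) (x : X) :
    Tendsto (fun n => (valueFun (extendTop ι F) (lipReg (extendTop ι H) n) (ι x)).toReal) atTop
      (𝓝 (valueFun (extendTop ι F) (extendTop ι H) (ι x)).toReal) := by
  have hHι := hH.extendTop hι.isClosedEmbedding
  obtain ⟨δ, hδ, hδH⟩ := hHι.exists_pos_le
  rw [← iSup_valueFun_lipReg (lowerSemicontinuous_extendTop hι.isClosedEmbedding hF)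
    hHι.lowerSemicontinuous hHι.isCompact_setOf_le hδ hδH]
  refine (ENNReal.tendsto_toReal ?_).comp
    (tendsto_atTop_iSup fun m n h => valueFun_mono (lipReg_mono h) _)
  exact ne_top_of_le_ne_top ENNReal.ofReal_ne_top
    (iSup_le fun n => valueFun_extendTop_le hι.injective hFb _ x)

variable [NormedSpace ℝ E]

theorem lipschitzWith_toReal_valueFun_lipReg (hι : Isometry ι)
    (hF : ∀ x, F x ≤ ENNReal.ofReal b) (n : ℕ) : LipschitzWith n fun x =>
      (valueFun (extendTop ι F) (lipReg (extendTop ι H) n) (ι x)).toReal :=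
  lipschitzWith_toReal_valueFun hι (fun z => by exact_mod_cast lipReg_le_natCast n z) fun x =>
    ne_top_of_le_ne_top ENNReal.ofReal_ne_top (valueFun_extendTop_le hι.injective hF _ x)

variable [MeasurableSpace X] [BorelSpace X] {μ : Measure X} [IsFiniteMeasure μ] {A : ℝ≥0}

theorem GlobalPoincare.oscillation_valueFun_lipReg_le (hA : GlobalPoincare A μ) (hp : 1 < p)
    (hb : 0 ≤ b) (hι : Isometry ι) (hF : ∀ x, F x ≤ ENNReal.ofReal b) (n : ℕ) :
    oscillation p μ
        (fun x => (valueFun (extendTop ι F) (lipReg (extendTop ι H) n) (ι x)).toReal) ≤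
      2 ^ p * μ univ * (A * ENNReal.ofReal p) ^ p * ∫⁻ x, H x ^ p ∂μ := by
  have hV := valueFun_extendTop_le hι.injective hF (lipReg (extendTop ι H) n)
  have hcont : Continuous fun x => lipReg (extendTop ι H) n (ι x) :=
    (continuous_lipReg n).comp hι.continuous
  refine (hA.oscillation_le hp (lipschitzWith_toReal_valueFun_lipReg hι hF n).locallyLipschitz hb
    (fun x => ⟨ENNReal.toReal_nonneg, ENNReal.toReal_le_of_le_ofReal hb (hV x)⟩) hcont.measurable
    fun x => slope_toReal_valueFun_le hι
      (fun y => ne_top_of_le_ne_top ENNReal.ofReal_ne_top (hV y))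
      (continuous_lipReg n).continuousAt.upperSemicontinuousAt).trans ?_
  gcongr with x
  exact (lipReg_le_self n _).trans_eq (extendTop_apply hι.injective x)

theorem GlobalPoincare.exists_ge_oscillation_le [CompleteSpace X]
    [TopologicalSpace.SeparableSpace X] (hA : GlobalPoincare A μ) (hp : 1 < p) {f : X → ℝ}
    (hf : IsUpperGradient f H) (hH : IsCoercive H) (hF : LowerSemicontinuous F) (hb : 0 ≤ b)
    (hFb : ∀ x, F x ≤ ENNReal.ofReal b) (hfF : ∀ x, ENNReal.ofReal (f x) ≤ F x) :
    ∃ U : X → ℝ, Measurable U ∧ f ≤ U ∧ (∀ x, ENNReal.ofReal (U x) ≤ F x) ∧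
      oscillation p μ U ≤
        2 ^ p * μ univ * (A * ENNReal.ofReal p) ^ p * ∫⁻ x, H x ^ p ∂μ := by
  have hι := kuratowskiEmbedding.isometry X
  have hVb := valueFun_extendTop_le hι.injective hFb (extendTop (kuratowskiEmbedding X) H)
  have hlim := tendsto_toReal_valueFun_lipReg hι hF hFb hH
  have hmeas (n : ℕ) :=
    (lipschitzWith_toReal_valueFun_lipReg (H := H) hι hFb n).continuous.measurable
  refine ⟨_, measurable_of_tendsto_metrizable hmeas (tendsto_pi_nhds.2 hlim), fun x => ?_,
    fun x => ?_, ?_⟩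
  · exact (ENNReal.ofReal_le_iff_le_toReal (ne_top_of_le_ne_top ENNReal.ofReal_ne_top (hVb x))).1
      (hf.ofReal_le_valueFun_extendTop hH.lowerSemicontinuous hfF hι x)
  · exact ENNReal.ofReal_toReal_le.trans
      ((valueFun_le_self _).trans_eq (extendTop_apply hι.injective x))
  · refine (oscillation_le_liminf (fun n => (hmeas n).aemeasurable) (ae_of_all _ hlim)).trans ?_
    exact liminf_le_of_frequently_le'
      (Frequently.of_forall (hA.oscillation_valueFun_lipReg_le hp hb hι hFb))

end LipschitzApproximation

section ExceptionalCurves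

variable {X : Type*} [MetricSpace X] {f : X → ℝ}

theorem IsUpperGradient.mono {g h : X → ℝ≥0∞} (hf : IsUpperGradient f g) (hgh : g ≤ h) :
    IsUpperGradient f h := fun γ =>
  (hf γ).trans (lintegral_mono fun _ => hgh _)

variable [MeasurableSpace X] {μ : Measure X} {p : ℝ} {ε : ℝ≥0∞} {Γ : Set (RectCurve X)}

theorem exists_le_lineIntegral_of_modulus_eq_zero (hp : 0 < p) (hΓ : modulus p μ Γ = 0)
    (hε : ε ≠ 0) (a : ℝ≥0) :
    ∃ ρ : X → ℝ≥0∞, Measurable ρ ∧ (∀ γ ∈ Γ, a ≤ γ.lineIntegral ρ) ∧ ∫⁻ x, ρ x ^ p ∂μ ≤ ε := by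
  have hap : (a : ℝ≥0∞) ^ p ≠ ∞ := ENNReal.rpow_ne_top_of_nonneg hp.le ENNReal.coe_ne_top
  have hpos : modulus p μ Γ < ε / (a : ℝ≥0∞) ^ p := by
    rw [hΓ]
    exact ENNReal.div_pos hε hap
  obtain ⟨ρ, ⟨hρ, hρΓ⟩, hρε⟩ : ∃ ρ : X → ℝ≥0∞, (Measurable ρ ∧ ∀ γ ∈ Γ, 1 ≤ γ.lineIntegral ρ) ∧
      ∫⁻ x, ρ x ^ p ∂μ < ε / (a : ℝ≥0∞) ^ p := by
    simpa only [modulus, iInf_lt_iff, exists_prop] using hpos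
  refine ⟨fun x => a * ρ x, hρ.const_mul _, fun γ hγ => ?_, ?_⟩
  · calc (a : ℝ≥0∞) ≤ a * γ.lineIntegral ρ := le_mul_of_one_le_right' (hρΓ γ hγ)
      _ = γ.lineIntegral fun x => a * ρ x := (lintegral_const_mul' _ _ ENNReal.coe_ne_top).symm
  · calc ∫⁻ x, (a * ρ x) ^ p ∂μ = (a : ℝ≥0∞) ^ p * ∫⁻ x, ρ x ^ p ∂μ := by
          simp only [ENNReal.mul_rpow_of_nonneg _ _ hp.le, lintegral_const_mul' _ _ hap]
      _ ≤ ε := mul_comm _ (∫⁻ x, ρ x ^ p ∂μ) ▸ ENNReal.mul_le_of_le_div hρε.le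

theorem exists_lineIntegral_eq_top_of_modulus_eq_zero (hp : 0 < p) (hΓ : modulus p μ Γ = 0)
    (hε : ε ≠ 0) :
    ∃ ρ : X → ℝ≥0∞, Measurable ρ ∧ (∀ γ ∈ Γ, γ.lineIntegral ρ = ∞) ∧ ∫⁻ x, ρ x ^ p ∂μ ≤ ε := by
  obtain ⟨δ, hδ, hδε⟩ := ENNReal.exists_pos_sum_of_countable' hε ℕ
  choose ρ hρ hρΓ hρδ using fun n : ℕ => exists_le_lineIntegral_of_modulus_eq_zero hp hΓ
    (hδ n).ne' n
  refine ⟨fun x => ⨆ n, ρ n x, Measurable.iSup hρ, fun γ hγ => ?_, ?_⟩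
  · refine ENNReal.eq_top_of_forall_nnreal_le fun r => ?_
    obtain ⟨n, hn⟩ := exists_nat_ge r
    calc (r : ℝ≥0∞) ≤ (n : ℝ≥0) := by exact_mod_cast hn
      _ ≤ γ.lineIntegral (ρ n) := hρΓ n γ hγ
      _ ≤ _ := lintegral_mono fun t => le_iSup (fun n => ρ n (γ.toFun t)) n
  · calc ∫⁻ x, (⨆ n, ρ n x) ^ p ∂μ ≤ ∫⁻ x, ∑' n, ρ n x ^ p ∂μ := by
          refine lintegral_mono fun x => ?_
          rw [← ENNReal.orderIsoRpow_apply p hp, OrderIso.map_iSup]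
          exact iSup_le fun n => ENNReal.le_tsum n
      _ = ∑' n, ∫⁻ x, ρ n x ^ p ∂μ := lintegral_tsum fun n => ((hρ n).pow_const p).aemeasurable
      _ ≤ ε := (ENNReal.tsum_le_tsum hρδ).trans hδε.le

theorem IsWeakUpperGradient.exists_isUpperGradient {g : X → ℝ≥0∞} (hp : 0 < p)
    (hg : IsWeakUpperGradient p μ f g) (hε : ε ≠ 0) :
    ∃ h : X → ℝ≥0∞, Measurable h ∧ IsUpperGradient f h ∧
      ∫⁻ x, h x ^ p ∂μ ≤ ∫⁻ x, g x ^ p ∂μ + ε := by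
  obtain ⟨ρ, hρ, hρtop, hρε⟩ := exists_lineIntegral_eq_top_of_modulus_eq_zero hp hg.2 hε
  refine ⟨g ⊔ ρ, hg.1.sup hρ, fun γ => ?_, ?_⟩
  · by_cases hγ : edist (f (γ.toFun γ.a)) (f (γ.toFun γ.b)) ≤ γ.lineIntegral g
    · exact hγ.trans (lintegral_mono fun _ => le_sup_left)
    · exact le_top.trans ((hρtop γ hγ).symm.trans_le (lintegral_mono fun _ => le_sup_right))
  · calc ∫⁻ x, (g x ⊔ ρ x) ^ p ∂μ ≤ ∫⁻ x, (g x ^ p + ρ x ^ p) ∂μ := by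
          refine lintegral_mono fun x => ?_
          rw [(ENNReal.monotone_rpow_of_nonneg hp.le).map_sup]
          exact max_le_add_of_nonneg bot_le bot_le
      _ = ∫⁻ x, g x ^ p ∂μ + ∫⁻ x, ρ x ^ p ∂μ := lintegral_add_left (hg.1.pow_const p) _
      _ ≤ ∫⁻ x, g x ^ p ∂μ + ε := by gcongr

end ExceptionalCurves

section CoerciveMajorant

variable {X : Type*} [TopologicalSpace X] {H W : X → ℝ≥0∞} {p : ℝ} {ε : ℝ≥0∞}

theorem IsCoercive.mono (hW : IsCoercive W) (hH : LowerSemicontinuous H) (hWH : W ≤ H) :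
    IsCoercive H where
  lowerSemicontinuous := hH
  isCompact_setOf_le a := (hW.isCompact_setOf_le a).of_isClosed_subset (hH.isClosed_preimage a)
    fun x hx => (hWH x).trans hx
  exists_pos_le := hW.exists_pos_le.imp fun _ h => ⟨h.1, fun x => (h.2 x).trans (hWH x)⟩

theorem IsCoercive.rpow_const (hW : IsCoercive W) (hp : 0 < p) :
    IsCoercive fun x => W x ^ p where
  lowerSemicontinuous := ENNReal.continuous_rpow_const.comp_lowerSemicontinuous
    hW.lowerSemicontinuous (ENNReal.monotone_rpow_of_nonneg hp.le)
  isCompact_setOf_le a := by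
    obtain ⟨N, hN⟩ := ENNReal.exists_nat_gt
      (ENNReal.rpow_ne_top_of_nonneg (inv_nonneg.2 hp.le) (ENNReal.natCast_ne_top a))
    simp only [← ENNReal.le_rpow_inv_iff hp]
    exact (hW.isCompact_setOf_le N).of_isClosed_subset (hW.lowerSemicontinuous.isClosed_preimage _)
      fun x hx => hx.trans hN.le
  exists_pos_le := by
    obtain ⟨δ, hδ, hδW⟩ := hW.exists_pos_le
    refine ⟨δ ^ p, NNReal.rpow_pos hδ, fun x => ?_⟩
    rw [ENNReal.coe_rpow_of_nonneg _ hp.le]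
    exact ENNReal.rpow_le_rpow (hδW x) hp.le

theorem isCoercive_add_tsum_indicator_compl [T2Space X] {K : ℕ → Set X}
    (hK : ∀ n, IsCompact (K n)) {δ : ℝ≥0} (hδ : 0 < δ) :
    IsCoercive fun x => δ + ∑' n, (K n)ᶜ.indicator (fun _ => (1 : ℝ≥0∞)) x := by
  have hlsc : LowerSemicontinuous fun x =>
      δ + ∑' n, (K n)ᶜ.indicator (fun _ => (1 : ℝ≥0∞)) x :=
    lowerSemicontinuous_const.add (lowerSemicontinuous_tsum fun n =>
      (hK n).isClosed.isOpen_compl.lowerSemicontinuous_indicator zero_le_one)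
  refine ⟨hlsc, fun a => ?_, δ, hδ, fun x => le_self_add⟩
  refine ((Finset.range (a + 1)).isCompact_biUnion fun n _ => hK n).of_isClosed_subset
    (hlsc.isClosed_preimage a) fun x (hx : _ ≤ (a : ℝ≥0∞)) => ?_
  by_contra hnot
  simp only [mem_iUnion, not_exists] at hnot
  refine hx.not_gt ?_
  calc (a : ℝ≥0∞) < ∑ n ∈ Finset.range (a + 1), 1 := by
        rw [Finset.sum_const, Finset.card_range, nsmul_one]
        exact_mod_cast a.lt_succ_self
    _ = ∑ n ∈ Finset.range (a + 1), (K n)ᶜ.indicator (fun _ => (1 : ℝ≥0∞)) x :=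
        Finset.sum_congr rfl fun n hn =>
          (indicator_of_mem (mem_compl (hnot n hn)) fun _ => (1 : ℝ≥0∞)).symm
    _ ≤ δ + ∑' n, (K n)ᶜ.indicator (fun _ => 1) x := (ENNReal.sum_le_tsum _).trans le_add_self

end CoerciveMajorant

section CoerciveUpperGradient

variable {X : Type*} [MetricSpace X] [CompleteSpace X] [TopologicalSpace.SeparableSpace X]
  [MeasurableSpace X] [BorelSpace X] {μ : Measure X} [IsFiniteMeasure μ] {p : ℝ} {ε : ℝ≥0∞}

theorem exists_isCoercive_lintegral_le (hε : ε ≠ 0) :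
    ∃ W : X → ℝ≥0∞, IsCoercive W ∧ ∫⁻ x, W x ∂μ ≤ ε := by
  have hε2 : ε / 2 ≠ 0 := (ENNReal.half_pos hε).ne'
  obtain ⟨δ, hδ, hδε⟩ := ENNReal.exists_nnreal_pos_mul_lt (measure_ne_top μ univ) hε2
  obtain ⟨η, hη, hηε⟩ := ENNReal.exists_pos_sum_of_countable' hε2 ℕ
  choose K hK hKη using fun n => isTightMeasureSet_iff_exists_isCompact_measure_compl_le.1
    (isTightMeasureSet_singleton (μ := μ)) (η n) (hη n)
  refine ⟨_, isCoercive_add_tsum_indicator_compl hK hδ, ?_⟩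
  have hind (n : ℕ) : ∫⁻ x, (K n)ᶜ.indicator (fun _ => 1) x ∂μ ≤ η n := by
    rw [lintegral_indicator_const (hK n).measurableSet.compl, one_mul]
    exact hKη n μ rfl
  rw [lintegral_add_left measurable_const, lintegral_const, lintegral_tsum fun n =>
    (measurable_const.indicator (hK n).measurableSet.compl).aemeasurable]
  exact (add_le_add hδε.le ((ENNReal.tsum_le_tsum hind).trans hηε.le)).trans_eq
    (ENNReal.add_halves ε)

theorem exists_isCoercive_ge (hp : 0 < p) {g : X → ℝ≥0∞} (hg : Measurable g) (hε : ε ≠ 0) :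
    ∃ H : X → ℝ≥0∞, IsCoercive H ∧ g ≤ H ∧ ∫⁻ x, H x ^ p ∂μ ≤ ∫⁻ x, g x ^ p ∂μ + ε := by
  have hε2 : ε / 2 ≠ 0 := (ENNReal.half_pos hε).ne'
  obtain ⟨Φ, hgΦ, hΦ, hΦε⟩ :=
    exists_le_lowerSemicontinuous_lintegral_ge (μ := μ) _ (hg.pow_const p) hε2
  obtain ⟨W, hW, hWε⟩ := exists_isCoercive_lintegral_le (μ := μ) hε2
  have hΦW : IsCoercive fun x => Φ x + W x :=
    hW.mono (hΦ.add hW.lowerSemicontinuous) fun x => le_add_self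
  refine ⟨_, hΦW.rpow_const (inv_pos.2 hp), fun x => ?_, ?_⟩
  · exact (ENNReal.le_rpow_inv_iff hp).2 ((hgΦ x).trans le_self_add)
  · simp only [ENNReal.rpow_inv_rpow hp.ne']
    rw [lintegral_add_left hΦ.measurable]
    exact (add_le_add hΦε hWε).trans_eq (by rw [add_assoc, ENNReal.add_halves])

theorem IsWeakUpperGradient.exists_isCoercive (hp : 0 < p) {f : X → ℝ} {g : X → ℝ≥0∞}
    (hg : IsWeakUpperGradient p μ f g) (hε : ε ≠ 0) :
    ∃ H : X → ℝ≥0∞, IsUpperGradient f H ∧ IsCoercive H ∧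
      ∫⁻ x, H x ^ p ∂μ ≤ ∫⁻ x, g x ^ p ∂μ + ε := by
  have hε2 : ε / 2 ≠ 0 := (ENNReal.half_pos hε).ne'
  obtain ⟨h, hh, hfh, hhg⟩ := hg.exists_isUpperGradient hp hε2
  obtain ⟨H, hH, hhH, hHh⟩ := exists_isCoercive_ge (μ := μ) hp hh hε2
  refine ⟨H, hfh.mono hhH, hH, hHh.trans ?_⟩
  calc ∫⁻ x, h x ^ p ∂μ + ε / 2 ≤ ∫⁻ x, g x ^ p ∂μ + ε / 2 + ε / 2 := by gcongr
    _ = ∫⁻ x, g x ^ p ∂μ + ε := by rw [add_assoc, ENNReal.add_halves]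

end CoerciveUpperGradient

section Approximation

variable {α : Type*} [MeasurableSpace α] {μ : Measure α} {f : α → ℝ}

theorem tendsto_ae_of_tsum_lintegral_ofReal_sub_ne_top {U : ℕ → α → ℝ} (hf : AEMeasurable f μ)
    (hU : ∀ n, AEMeasurable (U n) μ) (hfU : ∀ n, f ≤ U n)
    (hsum : ∑' n, ∫⁻ x, ENNReal.ofReal (U n x - f x) ∂μ ≠ ∞) :
    ∀ᵐ x ∂μ, Tendsto (fun n => U n x) atTop (𝓝 (f x)) := by
  have hmeas (n : ℕ) : AEMeasurable (fun x => ENNReal.ofReal (U n x - f x)) μ :=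
    ((hU n).sub hf).ennreal_ofReal
  rw [← lintegral_tsum hmeas] at hsum
  filter_upwards [ae_lt_top' (AEMeasurable.tsum hmeas) hsum] with x hx
  have hsub := (ENNReal.tendsto_toReal ENNReal.zero_ne_top).comp
    (ENNReal.tendsto_atTop_zero_of_tsum_ne_top hx.ne)
  refine tendsto_sub_nhds_zero_iff.1 (hsub.congr fun n => ?_)
  exact ENNReal.toReal_ofReal (sub_nonneg.2 (hfU n x))

theorem exists_lowerSemicontinuous_ge_of_forall_mem_Icc [TopologicalSpace α] [μ.WeaklyRegular]
    [BorelSpace α] [IsFiniteMeasure μ] (hf : AEMeasurable f μ) {b : ℝ} (hfb : ∀ x, f x ∈ Icc 0 b)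
    {ε : ℝ≥0∞} (hε : ε ≠ 0) :
    ∃ F : α → ℝ≥0∞, LowerSemicontinuous F ∧ (∀ x, ENNReal.ofReal (f x) ≤ F x) ∧
      (∀ x, F x ≤ ENNReal.ofReal b) ∧
      ∫⁻ x, F x ∂μ ≤ ∫⁻ x, ENNReal.ofReal (f x) ∂μ + ε := by
  obtain ⟨F, hfF, hF, hFε⟩ := exists_lt_lowerSemicontinuous_lintegral_ge_of_aemeasurable (μ := μ)
    (fun x => (f x).toNNReal) hf.real_toNNReal hε
  exact ⟨fun x => min (F x) (ENNReal.ofReal b), hF.inf lowerSemicontinuous_const,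
    fun x => le_min (hfF x).le (ENNReal.ofReal_le_ofReal (hfb x).2), fun x => min_le_right _ _,
    (lintegral_mono fun x => min_le_left _ _).trans hFε⟩

theorem lintegral_ofReal_sub_le [IsFiniteMeasure μ] {U : α → ℝ} (hf : AEMeasurable f μ) {b : ℝ}
    (hfb : ∀ x, f x ∈ Icc 0 b) (hfU : f ≤ U) {ε : ℝ≥0∞}
    (hU : ∫⁻ x, ENNReal.ofReal (U x) ∂μ ≤ ∫⁻ x, ENNReal.ofReal (f x) ∂μ + ε) :
    ∫⁻ x, ENNReal.ofReal (U x - f x) ∂μ ≤ ε := by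
  have hfin : ∫⁻ x, ENNReal.ofReal (f x) ∂μ ≠ ∞ := by
    refine ne_top_of_le_ne_top (b := ENNReal.ofReal b * μ univ) (by finiteness) ?_
    rw [← lintegral_const]
    exact lintegral_mono fun x => ENNReal.ofReal_le_ofReal (hfb x).2
  refine (ENNReal.add_le_add_iff_left hfin).1 (le_trans (le_of_eq ?_) hU)
  rw [← lintegral_add_left' hf.ennreal_ofReal]
  refine lintegral_congr fun x => ?_
  rw [← ENNReal.ofReal_add (hfb x).1 (sub_nonneg.2 (hfU x)), add_sub_cancel]

end Approximation

section SobolevPoincare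

variable {X : Type*} [MetricSpace X] [MeasurableSpace X] {μ : Measure X} {p : ℝ} {f : X → ℝ}
  {g : X → ℝ≥0∞}

theorem IsWeakUpperGradient.comp_lipschitz (hg : IsWeakUpperGradient p μ f g) {φ : ℝ → ℝ}
    (hφ : LipschitzWith 1 φ) : IsWeakUpperGradient p μ (φ ∘ f) g := by
  refine ⟨hg.1, modulus_null_mono (fun γ hγ => ?_) hg.2⟩
  refine fun hle : edist (f (γ.toFun γ.a)) (f (γ.toFun γ.b)) ≤ γ.lineIntegral g => hγ ?_
  exact (by simpa using hφ (f (γ.toFun γ.a)) (f (γ.toFun γ.b)) : _ ≤ _).trans hle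

variable [BorelSpace X] [CompleteSpace X] [TopologicalSpace.SeparableSpace X] [IsFiniteMeasure μ]
  {A : ℝ≥0}

theorem IsWeakUpperGradient.exists_oscillation_le_add (hg : IsWeakUpperGradient p μ f g)
    (hA : GlobalPoincare A μ) (hp : 1 < p) (hf : AEMeasurable f μ) {b : ℝ} (hb : 0 ≤ b)
    (hfb : ∀ x, f x ∈ Icc 0 b) {ε : ℝ≥0∞} (hε : ε ≠ 0) :
    ∃ U : X → ℝ, Measurable U ∧ f ≤ U ∧ ∫⁻ x, ENNReal.ofReal (U x - f x) ∂μ ≤ ε ∧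
      oscillation p μ U ≤
        2 ^ p * μ univ * (A * ENNReal.ofReal p) ^ p * (∫⁻ x, g x ^ p ∂μ + ε) := by
  obtain ⟨H, hfH, hH, hHg⟩ := hg.exists_isCoercive (by linarith) hε
  obtain ⟨F, hF, hfF, hFb, hFε⟩ := exists_lowerSemicontinuous_ge_of_forall_mem_Icc hf hfb hε
  obtain ⟨U, hU, hfU, hUF, hUH⟩ := hA.exists_ge_oscillation_le hp hfH hH hF hb hFb hfF
  exact ⟨U, hU, hfU, lintegral_ofReal_sub_le hf hfb hfU ((lintegral_mono hUF).trans hFε),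
    hUH.trans (by gcongr)⟩

theorem IsWeakUpperGradient.oscillation_le_of_forall_mem_Icc (hg : IsWeakUpperGradient p μ f g)
    (hA : GlobalPoincare A μ) (hp : 1 < p) (hf : AEMeasurable f μ) {b : ℝ} (hb : 0 ≤ b)
    (hfb : ∀ x, f x ∈ Icc 0 b) :
    oscillation p μ f ≤ 2 ^ p * μ univ * (A * ENNReal.ofReal p) ^ p * ∫⁻ x, g x ^ p ∂μ := by
  obtain ⟨ε, hε, hε1⟩ := ENNReal.exists_pos_sum_of_countable' (one_ne_zero (α := ℝ≥0∞)) ℕ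
  have hεsum : ∑' n, ε n ≠ ∞ := (hε1.trans ENNReal.one_lt_top).ne
  choose U hU hfU hUε hUg using fun n =>
    hg.exists_oscillation_le_add hA hp hf hb hfb (hε n).ne'
  have hlim : ∀ᵐ x ∂μ, Tendsto (fun n => U n x) atTop (𝓝 (f x)) :=
    tendsto_ae_of_tsum_lintegral_ofReal_sub_ne_top hf (fun n => (hU n).aemeasurable) hfU
      (ne_top_of_le_ne_top hεsum (ENNReal.tsum_le_tsum hUε))
  set B := 2 ^ p * μ univ * (A * ENNReal.ofReal p) ^ p
  have hB : B ≠ ∞ := by finiteness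
  have hbound : Tendsto (fun n => B * (∫⁻ x, g x ^ p ∂μ + ε n)) atTop
      (𝓝 (B * ∫⁻ x, g x ^ p ∂μ)) := by
    refine ENNReal.Tendsto.const_mul ?_ (Or.inr hB)
    simpa using tendsto_const_nhds.add (ENNReal.tendsto_atTop_zero_of_tsum_ne_top hεsum)
  calc oscillation p μ f ≤ liminf (fun n => oscillation p μ (U n)) atTop :=
        oscillation_le_liminf (fun n => (hU n).aemeasurable) hlim
    _ ≤ liminf (fun n => B * (∫⁻ x, g x ^ p ∂μ + ε n)) atTop :=
        liminf_le_liminf (Eventually.of_forall hUg)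
    _ = B * ∫⁻ x, g x ^ p ∂μ := hbound.liminf_eq

theorem IsWeakUpperGradient.oscillation_le (hg : IsWeakUpperGradient p μ f g)
    (hA : GlobalPoincare A μ) (hp : 1 < p) (hf : AEMeasurable f μ) :
    oscillation p μ f ≤ 2 ^ p * μ univ * (A * ENNReal.ofReal p) ^ p * ∫⁻ x, g x ^ p ∂μ := by
  -- truncation to `[-n, n]`, shifted to be nonnegative
  let φ (n : ℕ) (t : ℝ) : ℝ := max (-n : ℝ) (Min.min t n) + n
  have hφ (n : ℕ) : LipschitzWith 1 (φ n) := by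
    simpa [φ] using ((LipschitzWith.id.min_const (n : ℝ)).const_max (-n : ℝ)).add
      (LipschitzWith.const (n : ℝ))
  have hφ_mem (n : ℕ) (t : ℝ) : φ n t ∈ Icc 0 (2 * n : ℝ) := by
    have : (0 : ℝ) ≤ n := n.cast_nonneg
    constructor
    · linarith [le_max_left (-n : ℝ) (Min.min t n)]
    · linarith [max_le (by linarith : (-n : ℝ) ≤ n) (min_le_right t (n : ℝ))]
  have hφf (n : ℕ) : AEMeasurable (φ n ∘ f) μ := (hφ n).continuous.measurable.comp_aemeasurable hf
  have hshift (n : ℕ) :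
      oscillation p μ (fun x => max (-n : ℝ) (Min.min (f x) n)) = oscillation p μ (φ n ∘ f) := by
    simp only [oscillation, φ, Function.comp_apply, edist_add_right]
  have hlim (x : X) : Tendsto (fun n : ℕ => max (-n : ℝ) (Min.min (f x) n)) atTop (𝓝 (f x)) := by
    refine tendsto_const_nhds.congr' ?_
    filter_upwards [eventually_ge_atTop ⌈|f x|⌉₊] with n hn
    obtain ⟨hlo, hhi⟩ := abs_le.1 (Nat.ceil_le.1 hn)
    rw [min_eq_left hhi, max_eq_right hlo]
  refine (oscillation_le_liminf (fun n => ?_) (ae_of_all _ hlim)).trans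
    (liminf_le_of_frequently_le' (Frequently.of_forall fun n => ?_))
  · exact aemeasurable_const.max (hf.min aemeasurable_const)
  · rw [hshift]
    exact (hg.comp_lipschitz (hφ n)).oscillation_le_of_forall_mem_Icc hA hp (hφf n)
      (by positivity) fun x => hφ_mem n (f x)

theorem IsSobolevUpperGradient.lintegral_edist_average_le (hg : IsSobolevUpperGradient p μ f g)
    (hA : GlobalPoincare A μ) (hp : 1 < p) (hf : Integrable f μ) :
    ∫⁻ x, edist (f x) (⨍ y, f y ∂μ) ^ p ∂μ ≤
      (2 * A * ENNReal.ofReal p) ^ p * ∫⁻ x, g x ^ p ∂μ := by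
  rcases eq_or_ne μ 0 with rfl | hμ
  · simp
  obtain ⟨-, f', hff', hg'⟩ := hg
  have hp0 : 0 ≤ p := by linarith
  calc ∫⁻ x, edist (f x) (⨍ y, f y ∂μ) ^ p ∂μ ≤ (μ univ)⁻¹ * oscillation p μ f :=
        lintegral_edist_average_le_oscillation hp.le hf
    _ = (μ univ)⁻¹ * oscillation p μ f' := by rw [oscillation_congr_ae hff']
    _ ≤ (μ univ)⁻¹ * (2 ^ p * μ univ * (A * ENNReal.ofReal p) ^ p * ∫⁻ x, g x ^ p ∂μ) := by
        gcongr
        exact hg'.oscillation_le hA hp (hf.aemeasurable.congr hff'.symm)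
    _ = (μ univ)⁻¹ * μ univ * (2 ^ p * (A * ENNReal.ofReal p) ^ p * ∫⁻ x, g x ^ p ∂μ) := by ring
    _ = (2 * A * ENNReal.ofReal p) ^ p * ∫⁻ x, g x ^ p ∂μ := by
        rw [ENNReal.inv_mul_cancel (by simpa using hμ) (measure_ne_top μ univ), one_mul,
          ← ENNReal.mul_rpow_of_nonneg _ _ hp0, mul_assoc 2]

theorem GlobalPoincare.exists_sobolevPoincare (hA : GlobalPoincare A μ) (hp : 1 < p) :
    ∃ C : ℝ≥0, 0 < C ∧ ∀ f : X → ℝ, MemSobolev p μ f →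
      ∫⁻ x, edist (f x) (⨍ y, f y ∂μ) ^ p ∂μ ≤
        C * ∫⁻ x, minimalUpperGradient p μ f x ^ p ∂μ := by
  have hp0 : 0 < p := by linarith
  refine ⟨(2 * A * p.toNNReal) ^ p + 1, by positivity, fun f hf => ?_⟩
  have hmin := (isMinimalUpperGradient_minimalUpperGradient hp0 hf).1
  refine (hmin.lintegral_edist_average_le hA hp
    (hf.1.integrable (ENNReal.one_le_ofReal.2 hp.le))).trans ?_
  gcongr
  push_cast [ENNReal.coe_rpow_of_nonneg _ hp0.le]
  exact le_self_add

end SobolevPoincare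

section SpectralGap

variable {X : Type*} [MetricSpace X] [MeasurableSpace X] {μ : Measure X}

theorem spectralGap_pos_of_poincare {C : ℝ≥0} (hC : ∀ f : X → ℝ, MemSobolev 2 μ f →
    ∫⁻ x, edist (f x) (⨍ y, f y ∂μ) ^ (2 : ℝ) ∂μ ≤
      C * ∫⁻ x, minimalUpperGradient 2 μ f x ^ (2 : ℝ) ∂μ) : 0 < spectralGap μ := by
  have hC0 : (0 : ℝ≥0∞) < (C : ℝ≥0∞)⁻¹ := ENNReal.inv_pos.2 ENNReal.coe_ne_top
  refine hC0.trans_le (le_iInf₂ fun u ⟨hu, hu0, hu1⟩ => ?_)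
  have hu2 : Integrable (fun x => u x ^ 2) μ := not_imp_comm.1 integral_undef (by simp [hu1])
  have hnorm : ∫⁻ x, edist (u x) (⨍ y, u y ∂μ) ^ (2 : ℝ) ∂μ = 1 := by
    rw [average_eq, hu0, smul_zero, ← ENNReal.ofReal_one, ← hu1,
      ofReal_integral_eq_lintegral_ofReal hu2 (ae_of_all _ fun x => sq_nonneg _)]
    refine lintegral_congr fun x => ?_
    rw [edist_zero_right, Real.enorm_eq_ofReal_abs, ENNReal.rpow_two,
      ← ENNReal.ofReal_pow (abs_nonneg _), sq_abs]
  have hle := hnorm ▸ hC u hu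
  simp only [ENNReal.rpow_two] at hle
  rw [ENNReal.inv_le_iff_le_mul]
  · exact hle
  · rintro - hC
    simp [hC] at hle
  · exact fun hC => absurd hC ENNReal.coe_ne_top

end SpectralGap

end MMS

theorem theorem2p3_general {X : Type*} [MetricSpace X] [CompleteSpace X]
    [TopologicalSpace.SeparableSpace X] [MeasurableSpace X] [BorelSpace X]
    (μ : Measure X) [IsFiniteMeasure μ] {A : ℝ≥0} (hA : MMS.GlobalPoincare A μ) :
    (∀ p : ℝ, 1 < p → ∃ C : ℝ≥0, 0 < C ∧ ∀ f : X → ℝ, MMS.MemSobolev p μ f →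
      ∫⁻ x, edist (f x) (⨍ y, f y ∂μ) ^ p ∂μ ≤
        C * ∫⁻ x, MMS.minimalUpperGradient p μ f x ^ p ∂μ) ∧
    0 < MMS.spectralGap μ := by
  refine ⟨fun p hp => hA.exists_sobolevPoincare hp, ?_⟩
  obtain ⟨C, -, hC⟩ := hA.exists_sobolevPoincare one_lt_two
  exact MMS.spectralGap_pos_of_poincare hC

theorem theorem2p3 {X : Type*} [MetricSpace X] [CompleteSpace X]
    [TopologicalSpace.SeparableSpace X] [MeasurableSpace X] [BorelSpace X]
    (μ : Measure X) [μ.IsOpenPosMeasure]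
    (hμ : ∀ s : Set X, Bornology.IsBounded s → μ s < ∞)
    (D : ℝ) (hD : ∀ x y : X, dist x y ≤ D) (hP : MMS.WeakLocalPoincare μ) :
    (∀ p : ℝ, 1 < p → ∃ C : ℝ≥0, 0 < C ∧ ∀ f : X → ℝ, MMS.MemSobolev p μ f →
      ∫⁻ x, edist (f x) (⨍ y, f y ∂μ) ^ p ∂μ ≤
        C * ∫⁻ x, MMS.minimalUpperGradient p μ f x ^ p ∂μ) ∧
    0 < MMS.spectralGap μ := by
  have : IsFiniteMeasure μ := ⟨hμ univ (Metric.isBounded_iff.2 ⟨D, fun x _ y _ => hD x y⟩)⟩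
  exact (hP.exists_globalPoincare hD).elim fun _ hA => theorem2p3_general μ hA
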